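/- Let $\varphi_k(t)=\sqrt{k+1/2}\,(2^kk!)^{-1}\frac{d^k}{dt^k}(t^2-1)^k$, $k\ge 0$, be the orthonormal Legendre polynomials on $[-1,1]$, $Q=[-1,1]^2$, $L_2=L_2(Q)$ (real-valued functions), and for $f\in L_2$ let $\langle f,\varphi_{k,j}\rangle=\int_Q f(t,\tau)\varphi_k(t)\varphi_j(\tau)\,d\tau\,dt$. For $\mu=(\mu_1,\mu_2)$ and $\underline k=\max\{1,k\}$ put $$\|f\|_{s,\mu}=\Big(\sum_{k,j\ge0}\underline k^{\,s\mu_1}\underline j^{\,s\mu_2}|\langle f,\varphi_{k,j}\rangle|^s\Big)^{1/s},\qquad f^{(r,0)}=\sum_{k\ge r}\sum_{j\ge 0}\langle f,\varphi_{k,j}\rangle\,\varphi_k^{(r)}(t)\varphi_j(\tau)\quad(\text{in }L_2).$$ For a finite set $\Omega\subset\{(k,j)\in\mathbb N_0^2: k\ge r\}$ and an arbitrary map $\psi:\mathbb R^{\Omega}\to L_2$ let $$\varepsilon_\delta(\psi,\Omega)=\sup_{\|f\|_{s,\mu}\le1}\ \sup_{y}\ \big\|f^{(r,0)}-\psi\big((y_{k,j})_{(k,j)\in\Omega}\big)\big\|_{L_2},$$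 where $y$ runs over all real sequences with $\|(\langle f,\varphi_{k,j}\rangle-y_{k,j})_{k,j}\|_{\ell_p}\le\delta$. The minimal radius of Galerkin information is $R_{N,\delta}=R^{(r,0)}_{N,\delta}(L^\mu_{s,2},L_2,\ell_p)=\inf_{\operatorname{card}\Omega\le N}\inf_\psi\varepsilon_\delta(\psi,\Omega)$. For $n\in\mathbb N$ and $\gamma\ge1$ the truncation method $\mathcal D_{n,\gamma}$ is the algorithm $y\mapsto\sum_{(k,j)\in\Gamma_{n,\gamma}}y_{k,j}\varphi_k^{(r)}(t)\varphi_j(\tau)$ on the hyperbolic cross $\Omega=\Gamma_{n,\gamma}=\{(k,j): kj^\gamma\le n,\ r\le k\le n,\ 0\le j\le (n/r)^{1/\gamma}\}$; $\varepsilon_\delta(\mathcal D_{n,\gamma})$ is its error. **Theorem.** Let $r\ge1$ be an integer, $2\le s<\infty$, $\mu_1>2r-\frac1s+\frac12$, $\mu_2>\mu_1-2r$, $1\le p\le\infty$. Put $\beta=\mu_1-2r+\frac1s-\frac12$ and $\nu=\mu_1-\frac1p+\frac1s$ (with $1/\infty=0$). Below, $x\asymp y$ in a hypothesis means $c_1y\le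 x\le c_2y$ with given $c_1,c_2>0$; the constants in the conclusions are positive and depend only on $r,s,\mu_1,\mu_2,p$, on $c_1,c_2$ and, where it occurs, on $\gamma$; and $0<\delta<1$, $N,n\in\mathbb N$. The series for $f^{(r,0)}$ converges unconditionally in $L_2$ whenever $\|f\|_{s,\mu}<\infty$, and the following hold. (a) If $N\asymp\delta^{-1/\nu}$, then $$R_{N,\delta}\asymp N^{-\mu_1+2r-1/s+1/2}\asymp\delta^{\beta/\nu}.$$ This order is attained by $\mathcal D_{n,\gamma}$ with $n\asymp\delta^{-1/\nu}$ and $1<\gamma<\frac{\mu_2+1/s-1/2}{\mu_1-2r+1/s-1/2}$: for all $n\asymp\delta^{-1/\nu}$ one has $\varepsilon_\delta(\mathcal D_{n,\gamma})\asymp\delta^{\beta/\nu}$; and if $N\asymp\delta^{-1/\nu}$ and $\delta$ is small enough (depending on the data above), there is $n\asymp\delta^{-1/\nu}$ with $\operatorname{card}\Gamma_{n,\gamma}\le N$, $\varepsilon_\delta(\mathcal D_{n,\gamma})\le CN^{-\beta}$ and $\varepsilon_\delta(\mathcal D_{n,\gamma})\le C\delta^{\beta/\nu}$. (b) If $N\asymp\delta^{-1/\nu}\ln\frac1\delta$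 and $N\ge2$, then $$C_1N^{-\beta}\le R_{N,\delta}\le C_2\Big(\frac N{\ln N}\Big)^{-\beta}\quad\text{and}\quad C_1\,\delta^{\beta/\nu}\Big(\ln\frac1\delta\Big)^{-\beta}\le R_{N,\delta}\le C_2\,\delta^{\beta/\nu}.$$ The upper bounds are attained by $\mathcal D_{n,1}$ with $n\asymp\delta^{-1/\nu}$: for all $n\asymp\delta^{-1/\nu}$ one has $\varepsilon_\delta(\mathcal D_{n,1})\le C\delta^{\beta/\nu}$; and if $N\asymp\delta^{-1/\nu}\ln\frac1\delta$ and $\delta$ is small enough, there is $n\asymp\delta^{-1/\nu}$ with $\operatorname{card}\Gamma_{n,1}\le N$, $\varepsilon_\delta(\mathcal D_{n,1})\le C(N/\ln N)^{-\beta}$ and $\varepsilon_\delta(\mathcal D_{n,1})\le C\delta^{\beta/\nu}$. -/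

import Mathlib

open MeasureTheory
open scoped ENNReal

noncomputable section

namespace NumDiff

/-- The orthonormal Legendre polynomial
`φ_k(t) = √(k + 1/2) (2^k k!)⁻¹ d^k/dt^k (t² - 1)^k`. -/
def legendre (k : ℕ) : Polynomial ℝ :=
  Polynomial.C (Real.sqrt ((k : ℝ) + 1 / 2) * ((2 : ℝ) ^ k * (k.factorial : ℝ))⁻¹) *
    (Polynomial.derivative^[k] ((Polynomial.X ^ 2 - 1) ^ k))

/-- The square `Q = [-1, 1]²`. -/
def square : Set (ℝ × ℝ) := Set.Icc (-1 : ℝ) 1 ×ˢ Set.Icc (-1 : ℝ) 1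

/-- Lebesgue measure on `Q`. -/
def squareMeasure : Measure (ℝ × ℝ) := (volume : Measure (ℝ × ℝ)).restrict square

/-- The real Hilbert space `L₂(Q)`. -/
abbrev L2Q : Type := Lp ℝ 2 squareMeasure

/-- The function `(t, τ) ↦ φ_k^{(r)}(t) φ_j(τ)`. -/
def legendreDerivFun (r k j : ℕ) (x : ℝ × ℝ) : ℝ :=
  (Polynomial.derivative^[r] (legendre k)).eval x.1 * (legendre j).eval x.2

theorem continuous_legendreDerivFun (r k j : ℕ) : Continuous (legendreDerivFun r k j) := by
  unfold legendreDerivFun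
  exact ((Polynomial.continuous _).comp continuous_fst).mul
    ((Polynomial.continuous _).comp continuous_snd)

theorem isCompact_square : IsCompact square := isCompact_Icc.prod isCompact_Icc

theorem memLp_legendreDerivFun (r k j : ℕ) :
    MemLp (legendreDerivFun r k j) 2 squareMeasure := by
  have : IsFiniteMeasure squareMeasure := by
    unfold squareMeasure
    exact ⟨by simpa using isCompact_square.measure_lt_top⟩
  obtain ⟨C, hC⟩ := isCompact_square.exists_bound_of_continuousOn
    (continuous_legendreDerivFun r k j).continuousOn
  refine MemLp.of_bound (continuous_legendreDerivFun r k j).aestronglyMeasurable C ?_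
  exact (ae_restrict_iff' isCompact_square.measurableSet).2 (Filter.Eventually.of_forall hC)

/-- The element `φ_k^{(r)} ⊗ φ_j` of `L₂(Q)`, for `i = (k, j)`. -/
def legendreDeriv (r : ℕ) (i : ℕ × ℕ) : L2Q :=
  (memLp_legendreDerivFun r i.1 i.2).toLp (legendreDerivFun r i.1 i.2)

/-- The Fourier-Legendre coefficient `⟨f, φ_{k,j}⟩`, for `i = (k, j)`. -/
def coeff (f : L2Q) (i : ℕ × ℕ) : ℝ := inner ℝ f (legendreDeriv 0 i)

/-- The norm `‖f‖_{s,μ} = (∑_{k,j} max(1,k)^{sμ₁} max(1,j)^{sμ₂} |⟨f, φ_{k,j}⟩|^s)^{1/s}`,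
with values in `[0, ∞]`. -/
def smoothNorm (s μ₁ μ₂ : ℝ) (f : L2Q) : ℝ≥0∞ :=
  (∑' i : ℕ × ℕ, ENNReal.ofReal
    ((max 1 (i.1 : ℝ)) ^ (s * μ₁) * (max 1 (i.2 : ℝ)) ^ (s * μ₂) * |coeff f i| ^ s)) ^ (1 / s)

/-- The terms `⟨f, φ_{k,j}⟩ φ_k^{(r)} ⊗ φ_j`, `k ≥ r`, `j ≥ 0`, of the series of `f^{(r,0)}`. -/
def derivTerm (r : ℕ) (f : L2Q) (i : {i : ℕ × ℕ // r ≤ i.1}) : L2Q :=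
  coeff f i.1 • legendreDeriv r i.1

/-- The partial derivative `f^{(r,0)}`, as the sum of its series in `L₂(Q)`. -/
def partialDeriv (r : ℕ) (f : L2Q) : L2Q := ∑' i, derivTerm r f i

/-- The numbers `y` are perturbations of the Fourier-Legendre coefficients of `f` of level
`δ` in the metric of `ℓ_p`: the sequence `⟨f, φ_{k,j}⟩ - y_{k,j}` has `ℓ_p` norm at most `δ`. -/
def IsPerturbation (p : ℝ≥0∞) (δ : ℝ) (f : L2Q) (y : ℕ × ℕ → ℝ) : Prop :=
  ∃ ξ : lp (fun _ : ℕ × ℕ => ℝ) p, (∀ i, ξ i = coeff f i - y i) ∧ ‖ξ‖ ≤ δ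

/-- The error over the unit ball of the class and over all `δ`-perturbations of an algorithm `ψ`
that uses the perturbed coefficients with indices in `Ω`. -/
def algError (r : ℕ) (s μ₁ μ₂ : ℝ) (p : ℝ≥0∞) (δ : ℝ) (Ω : Finset (ℕ × ℕ))
    (ψ : (Ω → ℝ) → L2Q) : ℝ≥0∞ :=
  ⨆ (f : L2Q) (_ : smoothNorm s μ₁ μ₂ f ≤ 1) (y : ℕ × ℕ → ℝ) (_ : IsPerturbation p δ f y),
    ‖partialDeriv r f - ψ (fun i => y i)‖ₑ

/-- The minimal radius `R^{(r,0)}_{N,δ}(L^μ_{s,2}, L₂, ℓ_p)` of the Galerkin information: the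
infimum of the error over all index sets `Ω ⊂ [r, ∞) × [0, ∞)` with at most `N` points and all
algorithms that use the coefficients with indices in `Ω`. -/
def minRadius (r : ℕ) (s μ₁ μ₂ : ℝ) (p : ℝ≥0∞) (N : ℕ) (δ : ℝ) : ℝ≥0∞ :=
  ⨅ (Ω : Finset (ℕ × ℕ)) (_ : ∀ i ∈ Ω, r ≤ i.1) (_ : Ω.card ≤ N) (ψ : (Ω → ℝ) → L2Q),
    algError r s μ₁ μ₂ p δ Ω ψ

/-- The hyperbolic cross
`Γ_{n,γ} = {(k, j) : k j^γ ≤ n, k = r, …, n, j = 0, …, (n/r)^{1/γ}}`. -/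
def hyperbolicCross (r n : ℕ) (γ : ℝ) : Finset (ℕ × ℕ) :=
  (Finset.Icc r n ×ˢ Finset.Icc 0 ⌊((n : ℝ) / (r : ℝ)) ^ (1 / γ)⌋₊).filter
    (fun i => (i.1 : ℝ) * (i.2 : ℝ) ^ γ ≤ (n : ℝ))

/-- The truncation method: `∑_{(k,j) ∈ Ω} y_{k,j} φ_k^{(r)} ⊗ φ_j`. -/
def truncation (r : ℕ) (Ω : Finset (ℕ × ℕ)) (y : Ω → ℝ) : L2Q :=
  ∑ i : Ω, y i • legendreDeriv r i.1

/-- The error of the truncation method on the hyperbolic cross `Γ_{n,γ}`. -/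
def truncError (r : ℕ) (s μ₁ μ₂ : ℝ) (p : ℝ≥0∞) (δ : ℝ) (n : ℕ) (γ : ℝ) : ℝ≥0∞ :=
  algError r s μ₁ μ₂ p δ (hyperbolicCross r n γ) (truncation r (hyperbolicCross r n γ))

/-- `μ₁ - 2r + 1/s - 1/2`. -/
def accExp (r : ℕ) (s μ₁ : ℝ) : ℝ := μ₁ - 2 * (r : ℝ) + 1 / s - 1 / 2

/-- `μ₁ - 1/p + 1/s`, where `1/p = 0` for `p = ∞`. -/
def noiseExp (s μ₁ : ℝ) (p : ℝ≥0∞) : ℝ := μ₁ - (p⁻¹).toReal + 1 / s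

/-- `c₁ y ≤ x ≤ c₂ y`. -/
def Between (c₁ c₂ y x : ℝ) : Prop := c₁ * y ≤ x ∧ x ≤ c₂ * y

/-- `c₁ y ≤ x ≤ c₂ y` for a quantity `x ∈ [0, ∞]`. -/
def EBetween (c₁ c₂ y : ℝ) (x : ℝ≥0∞) : Prop :=
  ENNReal.ofReal (c₁ * y) ≤ x ∧ x ≤ ENNReal.ofReal (c₂ * y)

end NumDiff

end

/-!
The argument works with the coefficients `a_{k,j} = ⟨f, φ_{k,j}⟩` only. Write `J = max 1 j`,
`β = accExp`, `ν = noiseExp`; the hyperbolic cross is `{k ≥ r, k J^γ ≤ n}`.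

Upper bounds. Integration by parts and the values of the derivatives of `φ_k` at `±1` give
`‖φ_k^{(r)}‖ ≤ C k^{2r-1/2}`. The functions `φ_k^{(r)} ⊗ φ_j` with different `j` are orthogonal,
and within one row `j` the triangle inequality in `k` already has the right order
(`exists_norm_sum_sq_le`). Hölder's inequality in `k` bounds the part of row `j` beyond
`k = n / J^γ` by `(n / J^γ)^{-β} J^{-μ₂}` times the `ℓ_s` norm of the weighted row. The sum over
`j` converges because `γ β < μ₂ + 1/s - 1/2`, and the tail is of order `n^{-β}`
(`exists_norm_tail_le`). This is also a Cauchy criterion, so that the series of the derivative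
converges unconditionally (`summable_derivTerm`). The noise on the cross is bounded row by row by
the power mean inequality and contributes `δ n^{2r+1/2-1/p} = δ n^{ν-β}`
(`exists_norm_noise_le`). Both errors are of order `δ^{β/ν}` when `n ≍ δ^{-1/ν}`
(`exists_truncError_le_rpow`). The cross has `O(n)` points for `γ > 1` and `O(n log n)` points for
`γ = 1`.

Lower bounds. If `f` has vanishing coefficients on `Ω`, the zero data are admissible for `f` and
for `-f`, so every algorithm has error at least `‖f^{(r,0)}‖`
(`enorm_partialDeriv_le_algError`). Take for `f` a multiple of the sum of the unobserved
`φ_k ⊗ φ_0` with `2rN ≤ k < 6rN`. There is no cancellation at `t = 1`, where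
`φ_k^{(r)}(1) ≥ c k^{2r+1/2}`, and a polynomial `q` of degree less than `L` satisfies
`q(1)² ≤ (L²/2) ‖q‖²` (`eval_one_sq_le`), which is read off from the reproducing kernel at `1`.
The result is `R_{N,δ} ≥ c N^{-β}` for all `N ≥ 1` and all noise levels (`exists_le_minRadius`).
-/

namespace NumDiff

/-! ### One-dimensional facts on the Legendre polynomials -/

section Legendre

open Polynomial

/-- The functional `p ↦ ∫_{-1}^1 p(t) dt` on polynomials. The `L₂[-1, 1]` inner product of two
polynomials `p`, `q` is `polyIntegral (p * q)`. -/
noncomputable def polyIntegral : ℝ[X] →ₗ[ℝ] ℝ where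
  toFun p := ∫ t in (-1 : ℝ)..1, p.eval t
  map_add' p q := by
    simp only [eval_add]
    exact intervalIntegral.integral_add (p.continuous.intervalIntegrable _ _)
      (q.continuous.intervalIntegrable _ _)
  map_smul' c p := by simp

theorem polyIntegral_apply (p : ℝ[X]) : polyIntegral p = ∫ t in (-1 : ℝ)..1, p.eval t := rfl

theorem polyIntegral_derivative (p : ℝ[X]) :
    polyIntegral (derivative p) = p.eval 1 - p.eval (-1) :=
  intervalIntegral.integral_eq_sub_of_hasDerivAt (fun x _ => p.hasDerivAt x)
    ((derivative p).continuous.intervalIntegrable _ _)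

theorem polyIntegral_derivative_mul (p q : ℝ[X]) :
    polyIntegral (derivative p * q) =
      p.eval 1 * q.eval 1 - p.eval (-1) * q.eval (-1) - polyIntegral (p * derivative q) := by
  have h := polyIntegral_derivative (p * q)
  rw [derivative_mul, map_add, eval_mul, eval_mul] at h
  linarith

theorem polyIntegral_C_mul (c : ℝ) (p : ℝ[X]) : polyIntegral (C c * p) = c * polyIntegral p := by
  rw [← smul_eq_C_mul, map_smul, smul_eq_mul]

theorem polyIntegral_mul_self_nonneg (p : ℝ[X]) : 0 ≤ polyIntegral (p * p) := by
  rw [polyIntegral_apply]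
  refine intervalIntegral.integral_nonneg (by norm_num) fun t _ => ?_
  rw [eval_mul]
  exact mul_self_nonneg _

/-- Repeated integration by parts without boundary terms. -/
theorem polyIntegral_iterate_derivative_mul (u q : ℝ[X]) (k : ℕ)
    (h1 : ∀ i < k, (derivative^[i] u).eval 1 = 0)
    (h2 : ∀ i < k, (derivative^[i] u).eval (-1) = 0) :
    polyIntegral (derivative^[k] u * q) = (-1) ^ k * polyIntegral (u * derivative^[k] q) := by
  induction k generalizing q with
  | zero => simp
  | succ k ih =>
    rw [Function.iterate_succ_apply', polyIntegral_derivative_mul, h1 k (by omega),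
      h2 k (by omega), ih _ (fun i hi => h1 i (by omega)) (fun i hi => h2 i (by omega)),
      ← Function.iterate_succ_apply]
    ring

theorem X_sq_sub_one_pow (k : ℕ) :
    ((X : ℝ[X]) ^ 2 - 1) ^ k = (X - C 1) ^ k * (X + C 1) ^ k := by
  rw [← mul_pow]; congr 1; rw [C_1]; ring

theorem eval_iterate_derivative_pow_eq_zero (k i : ℕ) (hi : i < k) {x : ℝ} (hx : x ^ 2 = 1) :
    (derivative^[i] (((X : ℝ[X]) ^ 2 - 1) ^ k)).eval x = 0 := by
  obtain ⟨q, hq⟩ := pow_sub_dvd_iterate_derivative_pow ((X : ℝ[X]) ^ 2 - 1) k i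
  rw [hq, eval_mul, eval_pow]
  simp [hx, Nat.sub_ne_zero_of_lt hi]

/-- The Legendre polynomial `φ_k` is orthogonal to all polynomials of degree less than `k`. -/
theorem polyIntegral_legendre_mul_eq_zero (k : ℕ) (q : ℝ[X]) (hq : q.degree < k) :
    polyIntegral (legendre k * q) = 0 := by
  rw [legendre, mul_assoc, polyIntegral_C_mul, polyIntegral_iterate_derivative_mul _ _ _
    (fun i hi => eval_iterate_derivative_pow_eq_zero k i hi (by norm_num))
    (fun i hi => eval_iterate_derivative_pow_eq_zero k i hi (by norm_num)),
    iterate_derivative_eq_zero_of_degree_lt hq]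
  simp

theorem natDegree_legendre_le (k : ℕ) : (legendre k).natDegree ≤ k := by
  unfold legendre
  refine (natDegree_C_mul_le _ _).trans ((natDegree_iterate_derivative _ _).trans ?_)
  have h : (((X : ℝ[X]) ^ 2 - 1) ^ k).natDegree ≤ k * 2 := by
    refine natDegree_pow_le_of_le k ?_
    rw [← C_1]
    exact (natDegree_X_pow_sub_C).le
  omega

theorem degree_lt_of_natDegree_le_of_coeff_eq_zero {p : ℝ[X]} {k : ℕ} (h : p.natDegree ≤ k)
    (hc : p.coeff k = 0) : p.degree < k := by
  rw [degree_lt_iff_coeff_zero]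
  intro m hm
  rcases hm.eq_or_lt with rfl | hm
  · exact hc
  · exact coeff_eq_zero_of_natDegree_lt (by omega)

/-- The values of the derivatives at `1`, from the Leibniz rule for
`(t² - 1)^k = (t - 1)^k (t + 1)^k`. -/
theorem eval_one_iterate_derivative_legendre (k i : ℕ) :
    (derivative^[i] (legendre k)).eval 1 =
      Real.sqrt ((k : ℝ) + 1 / 2) * ((k + i).choose i * k.descFactorial i / 2 ^ i) := by
  have key : (derivative^[k + i] (((X : ℝ[X]) ^ 2 - 1) ^ k)).eval 1 =
      ((k + i).choose i : ℝ) * (k.factorial * (k.descFactorial i * 2 ^ (k - i))) := by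
    rw [X_sq_sub_one_pow, iterate_derivative_mul, eval_finsetSum,
      Finset.sum_eq_single_of_mem i (by simp)]
    · rw [Nat.add_sub_cancel, iterate_derivative_X_sub_pow_self, iterate_derivative_X_add_pow]
      simp
      left; left; norm_num
    · intro b hb hbi
      rw [iterate_derivative_X_sub_pow]
      rw [Finset.mem_range] at hb
      rcases lt_or_gt_of_ne hbi with h | h
      · have : k.descFactorial (k + i - b) = 0 := Nat.descFactorial_eq_zero_iff_lt.2 (by omega)
        simp [this]
      · have : k - (k + i - b) ≠ 0 := by omega
        simp [this]
  rw [legendre, iterate_derivative_C_mul, ← Function.iterate_add_apply, add_comm i k, eval_mul,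
    eval_C, key]
  have hk : (k.factorial : ℝ) ≠ 0 := by positivity
  by_cases hik : i ≤ k
  · have h2 : (2 : ℝ) ^ k = 2 ^ (k - i) * 2 ^ i := by rw [← pow_add, Nat.sub_add_cancel hik]
    rw [h2]
    field_simp
  · rw [Nat.descFactorial_eq_zero_iff_lt.2 (by omega)]
    simp

theorem iterate_derivative_comp_neg_X (p : ℝ[X]) (i : ℕ) :
    derivative^[i] (p.comp (-X)) = (-1) ^ i * (derivative^[i] p).comp (-X) := by
  induction i generalizing p with
  | zero => simp
  | succ i ih =>
    rw [Function.iterate_succ_apply, derivative_comp, derivative_neg, derivative_X,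
      neg_one_mul, iterate_derivative_neg, ih, Function.iterate_succ_apply]
    ring

/-- The parity `φ_k(-t) = (-1)^k φ_k(t)` carries the values at `1` over to `-1`. -/
theorem abs_eval_neg_one_iterate_derivative_legendre (k i : ℕ) :
    |(derivative^[i] (legendre k)).eval (-1)| = |(derivative^[i] (legendre k)).eval 1| := by
  have hpar : (legendre k).comp (-X) = (-1) ^ k * legendre k := by
    have h1 : (((X : ℝ[X]) ^ 2 - 1) ^ k).comp (-X) = ((X : ℝ[X]) ^ 2 - 1) ^ k := by simp
    have h2 := iterate_derivative_comp_neg_X (((X : ℝ[X]) ^ 2 - 1) ^ k) k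
    rw [h1] at h2
    rw [legendre, mul_comp, C_comp]
    have h3 : ((-1 : ℝ[X]) ^ k) * (-1) ^ k = 1 := by rw [← mul_pow]; simp
    set c : ℝ := Real.sqrt ((k : ℝ) + 1 / 2) * ((2 : ℝ) ^ k * (k.factorial : ℝ))⁻¹
    linear_combination (-C c * (-1) ^ k) * h2 -
      (C c * (derivative^[k] (((X : ℝ[X]) ^ 2 - 1) ^ k)).comp (-X)) * h3
  have h4 := iterate_derivative_comp_neg_X (legendre k) i
  rw [hpar] at h4
  have h5 : ((-1 : ℝ[X]) ^ k) = C ((-1) ^ k) := by simp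
  rw [h5, iterate_derivative_C_mul] at h4
  have h6 := congrArg (fun p : ℝ[X] => |p.eval 1|) h4
  simpa [abs_mul] using h6.symm

theorem eval_one_legendre_mul_self (k : ℕ) :
    (legendre k).eval 1 * (legendre k).eval 1 = (k : ℝ) + 1 / 2 := by
  have h := eval_one_iterate_derivative_legendre k 0
  simp only [Function.iterate_zero, id] at h
  rw [h]
  simp only [Nat.choose_zero_right, Nat.descFactorial_zero, pow_zero, Nat.cast_one]
  rw [mul_one, div_one, mul_one, Real.mul_self_sqrt (by positivity)]

/-- The norm of `φ_k` is read off from `∫ (t φ_k²)' = 2 φ_k(1)²`, since `t φ_k' - k φ_k` has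
degree less than `k`. -/
theorem polyIntegral_legendre_mul_self (k : ℕ) : polyIntegral (legendre k * legendre k) = 1 := by
  have hlow : polyIntegral (legendre k * (X * derivative (legendre k) - C (k : ℝ) * legendre k))
      = 0 := by
    refine polyIntegral_legendre_mul_eq_zero k _ ?_
    have hdeg := natDegree_legendre_le k
    rw [degree_lt_iff_coeff_zero]
    intro m hm
    rcases m with _ | m
    · obtain rfl : k = 0 := by omega
      simp
    · rw [coeff_sub, coeff_X_mul, coeff_derivative, coeff_C_mul]
      rcases hm.eq_or_lt with h | h
      · rw [h]; push_cast; ring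
      · rw [coeff_eq_zero_of_natDegree_lt (by omega)]; ring
  have hbd := polyIntegral_derivative (X * (legendre k * legendre k))
  have hval : ((legendre k).eval (-1)) ^ 2 = ((legendre k).eval 1) ^ 2 :=
    sq_eq_sq_iff_abs_eq_abs _ _ |>.2 (abs_eval_neg_one_iterate_derivative_legendre k 0)
  have hsq := eval_one_legendre_mul_self k
  have hexp : derivative (X * (legendre k * legendre k)) =
      C (2 * (k : ℝ) + 1) * (legendre k * legendre k) +
      C 2 * (legendre k * (X * derivative (legendre k) - C (k : ℝ) * legendre k)) := by
    simp only [derivative_mul, derivative_X, map_add, map_mul, map_one]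
    have : (C (2 : ℝ)) = 2 := rfl
    rw [this]
    ring
  rw [hexp, map_add, polyIntegral_C_mul, polyIntegral_C_mul, hlow] at hbd
  simp only [eval_mul, eval_X] at hbd
  have hk : (2 * (k : ℝ) + 1) ≠ 0 := by positivity
  apply mul_left_cancel₀ hk
  linarith

theorem polyIntegral_legendre_mul_legendre (k l : ℕ) :
    polyIntegral (legendre k * legendre l) = if k = l then 1 else 0 := by
  have hlt : ∀ k l : ℕ, l < k → polyIntegral (legendre k * legendre l) = 0 := fun k l h =>
    polyIntegral_legendre_mul_eq_zero k _ ((degree_le_natDegree).trans_lt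
      (by exact_mod_cast (natDegree_legendre_le l).trans_lt h))
  split_ifs with h
  · rw [h, polyIntegral_legendre_mul_self]
  · rcases lt_or_gt_of_ne h with h | h
    · rw [mul_comm, hlt l k h]
    · exact hlt k l h

theorem eval_one_iterate_derivative_legendre_nonneg (k i : ℕ) :
    0 ≤ (derivative^[i] (legendre k)).eval 1 := by
  rw [eval_one_iterate_derivative_legendre]
  positivity

theorem eval_one_iterate_derivative_legendre_le (k i : ℕ) (hk : 1 ≤ k) :
    (derivative^[i] (legendre k)).eval 1 ≤
      Real.sqrt ((k : ℝ) + 1 / 2) * (((i : ℝ) + 1) ^ i * (k : ℝ) ^ (2 * i)) := by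
  rw [eval_one_iterate_derivative_legendre]
  refine mul_le_mul_of_nonneg_left ?_ (Real.sqrt_nonneg _)
  have hk' : (1 : ℝ) ≤ k := by exact_mod_cast hk
  have h1 : (((k + i).choose i : ℕ) : ℝ) ≤ (((i : ℝ) + 1) * k) ^ i := by
    calc (((k + i).choose i : ℕ) : ℝ) ≤ ((k + i : ℕ) : ℝ) ^ i := by
          exact_mod_cast Nat.choose_le_pow (k + i) i
      _ ≤ _ := by
          refine pow_le_pow_left₀ (by positivity) ?_ _
          push_cast
          nlinarith [(Nat.cast_nonneg i : (0 : ℝ) ≤ i)]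
  have h2 : ((k.descFactorial i : ℕ) : ℝ) ≤ (k : ℝ) ^ i := by
    exact_mod_cast Nat.descFactorial_le_pow k i
  calc _ ≤ (((k + i).choose i : ℕ) : ℝ) * (k.descFactorial i : ℕ) :=
        div_le_self (by positivity) (one_le_pow₀ (by norm_num))
    _ ≤ (((i : ℝ) + 1) * k) ^ i * (k : ℝ) ^ i := by gcongr
    _ = _ := by rw [mul_pow, two_mul, pow_add]; ring

theorem le_eval_one_iterate_derivative_legendre (k r : ℕ) (hr : 1 ≤ r) (hk : 2 * r ≤ k) :
    ((r.factorial : ℝ) * 4 ^ r)⁻¹ * (Real.sqrt k * (k : ℝ) ^ (2 * r)) ≤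
      (derivative^[r] (legendre k)).eval 1 := by
  rw [eval_one_iterate_derivative_legendre]
  have h1 : (k : ℝ) ^ r / r.factorial ≤ (k + r).choose r := by
    refine le_trans ?_ (Nat.pow_le_choose (α := ℝ) r (k + r))
    gcongr
    omega
  have h2 : ((k : ℝ) / 2) ^ r ≤ k.descFactorial r := by
    have h3 : (((k + 1 - r : ℕ) : ℝ)) ^ r ≤ k.descFactorial r := by
      exact_mod_cast Nat.pow_sub_le_descFactorial k r
    refine le_trans (pow_le_pow_left₀ (by positivity) ?_ _) h3
    rw [div_le_iff₀ (by norm_num)]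
    have : k ≤ (k + 1 - r) * 2 := by omega
    exact_mod_cast this
  have h4 : Real.sqrt k ≤ Real.sqrt ((k : ℝ) + 1 / 2) := Real.sqrt_le_sqrt (by linarith)
  calc _ = Real.sqrt k * ((k : ℝ) ^ r / r.factorial * ((k : ℝ) / 2) ^ r / 2 ^ r) := by
        have h5 : (4 : ℝ) ^ r = 2 ^ r * 2 ^ r := by rw [← mul_pow]; norm_num
        rw [h5, div_pow, two_mul, pow_add]
        field_simp
    _ ≤ _ := by gcongr

/-- `‖φ_k^{(r)}‖² ≤ C k^{4r-1}`: after `r` integrations by parts only boundary terms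
`φ_k^{(a)}(±1) φ_k^{(b)}(±1)` with `a + b = 2r - 1` are left, because `φ_k^{(2r)}` is orthogonal
to `φ_k`. -/
theorem exists_polyIntegral_iterate_derivative_le (r : ℕ) (hr : 1 ≤ r) :
    ∃ C : ℝ, 0 < C ∧ ∀ k : ℕ, 1 ≤ k →
      polyIntegral (derivative^[r] (legendre k) * derivative^[r] (legendre k)) ≤
        C * (k : ℝ) ^ (4 * r - 1) := by
  set D : ℝ := 4 * (2 * (r : ℝ) + 1) ^ (2 * r) with hD
  have hDpos : 0 < D := by positivity
  have hbd : ∀ k : ℕ, 1 ≤ k → ∀ a b : ℕ, a + b = 2 * r - 1 →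
      |(derivative^[a] (legendre k)).eval 1 * (derivative^[b] (legendre k)).eval 1 -
        (derivative^[a] (legendre k)).eval (-1) * (derivative^[b] (legendre k)).eval (-1)| ≤
        D * (k : ℝ) ^ (4 * r - 1) := by
    intro k hk a b hab
    have hk' : (1 : ℝ) ≤ k := by exact_mod_cast hk
    have hA := eval_one_iterate_derivative_legendre_le k a hk
    have hB := eval_one_iterate_derivative_legendre_le k b hk
    have hA0 := eval_one_iterate_derivative_legendre_nonneg k a
    have hB0 := eval_one_iterate_derivative_legendre_nonneg k b
    have ha : ((a : ℝ) + 1) ^ a ≤ (2 * (r : ℝ) + 1) ^ a := by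
      gcongr
      have : a ≤ 2 * r := by omega
      exact_mod_cast this
    have hb : ((b : ℝ) + 1) ^ b ≤ (2 * (r : ℝ) + 1) ^ b := by
      gcongr
      have : b ≤ 2 * r := by omega
      exact_mod_cast this
    have hmul : (derivative^[a] (legendre k)).eval 1 * (derivative^[b] (legendre k)).eval 1 ≤
        (2 * (r : ℝ) + 1) ^ (2 * r) * (2 * (k : ℝ) ^ (4 * r - 1)) := by
      calc _ ≤ (Real.sqrt ((k : ℝ) + 1 / 2) * ((2 * (r : ℝ) + 1) ^ a * (k : ℝ) ^ (2 * a))) *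
            (Real.sqrt ((k : ℝ) + 1 / 2) * ((2 * (r : ℝ) + 1) ^ b * (k : ℝ) ^ (2 * b))) := by
            refine mul_le_mul (hA.trans ?_) (hB.trans ?_) hB0 (by positivity) <;> gcongr
        _ = (2 * (r : ℝ) + 1) ^ (a + b) * (((k : ℝ) + 1 / 2) * (k : ℝ) ^ (2 * (a + b))) := by
            have hs := Real.mul_self_sqrt (show (0 : ℝ) ≤ (k : ℝ) + 1 / 2 by positivity)
            rw [pow_add, mul_add 2 a b, pow_add]
            linear_combination ((2 * (r : ℝ) + 1) ^ a * (2 * (r : ℝ) + 1) ^ b *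
              (k : ℝ) ^ (2 * a) * (k : ℝ) ^ (2 * b)) * hs
        _ ≤ (2 * (r : ℝ) + 1) ^ (2 * r) * ((2 * k) * (k : ℝ) ^ (4 * r - 2)) := by
            have he : 2 * (a + b) = 4 * r - 2 := by omega
            rw [he]
            gcongr
            · linarith [(Nat.cast_nonneg r : (0 : ℝ) ≤ r)]
            · omega
            · linarith
        _ = _ := by
            have he : 4 * r - 1 = (4 * r - 2) + 1 := by omega
            rw [he, pow_succ]; ring
    have h1 := abs_eval_neg_one_iterate_derivative_legendre k a
    have h2 := abs_eval_neg_one_iterate_derivative_legendre k b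
    refine (abs_sub _ _).trans ?_
    rw [abs_mul, abs_mul, h1, h2, abs_of_nonneg hA0, abs_of_nonneg hB0, hD]
    linarith
  have hind : ∀ k : ℕ, 1 ≤ k → ∀ b a : ℕ, a + b = 2 * r →
      |polyIntegral (derivative^[a] (legendre k) * derivative^[b] (legendre k))| ≤
        b * (D * (k : ℝ) ^ (4 * r - 1)) := by
    intro k hk b
    induction b with
    | zero =>
      intro a ha
      have hz : polyIntegral (legendre k * derivative^[a] (legendre k)) = 0 := by
        refine polyIntegral_legendre_mul_eq_zero k _ ?_
        refine degree_le_natDegree.trans_lt ?_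
        have h1 := natDegree_iterate_derivative (legendre k) a
        have h2 := natDegree_legendre_le k
        exact_mod_cast (by omega : (derivative^[a] (legendre k)).natDegree < k)
      rw [Function.iterate_zero, id, mul_comm, hz]
      simp
    | succ b ih =>
      intro a ha
      rw [Function.iterate_succ_apply', mul_comm, polyIntegral_derivative_mul,
        ← mul_comm (derivative _), ← Function.iterate_succ_apply' derivative a]
      have h1 := ih (a + 1) (by omega)
      have h2 := hbd k hk b a (by omega)
      refine (abs_sub _ _).trans ?_
      push_cast
      linarith
  refine ⟨r * D, by positivity, fun k hk => ?_⟩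
  have := hind k hk r r (by omega)
  rw [mul_assoc]
  exact (le_abs_self _).trans this

/-- The kernel `∑_{l<L} φ_l(1) φ_l`, which reproduces the value at `1` of the polynomials of degree
less than `L`. -/
noncomputable def endpointKernel (L : ℕ) : ℝ[X] :=
  ∑ l ∈ Finset.range L, C ((legendre l).eval 1) * legendre l

theorem polyIntegral_mul_endpointKernel (L : ℕ) (q : ℝ[X]) (hq : q.degree < L) :
    polyIntegral (q * endpointKernel L) = q.eval 1 := by
  induction L generalizing q with
  | zero =>
    have : q = 0 := by
      rw [← degree_eq_bot]; exact Nat.WithBot.lt_zero_iff.1 (by simpa using hq)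
    simp [this]
  | succ L ih =>
    have hlead : (legendre L).coeff L ≠ 0 := by
      intro h
      have := polyIntegral_legendre_mul_eq_zero L (legendre L)
        (degree_lt_of_natDegree_le_of_coeff_eq_zero (natDegree_legendre_le L) h)
      rw [polyIntegral_legendre_mul_self] at this
      norm_num at this
    -- split off the component along `φ_L`; the remainder has degree less than `L`
    set c : ℝ := q.coeff L / (legendre L).coeff L with hc
    set q' : ℝ[X] := q - C c * legendre L with hq'
    have hdeg : q'.degree < L := by
      refine degree_lt_of_natDegree_le_of_coeff_eq_zero ?_ ?_
      · refine (natDegree_sub_le _ _).trans (max_le ?_ ?_)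
        · exact natDegree_le_iff_coeff_eq_zero.2 fun m hm =>
            degree_lt_iff_coeff_zero _ _ |>.1 hq m (by omega)
        · exact (natDegree_C_mul_le _ _).trans (natDegree_legendre_le L)
      · rw [hq', coeff_sub, coeff_C_mul, hc, div_mul_cancel₀ _ hlead, sub_self]
    have hqq : q = q' + C c * legendre L := by rw [hq']; ring
    have hker : endpointKernel (L + 1) =
        endpointKernel L + C ((legendre L).eval 1) * legendre L := Finset.sum_range_succ _ _
    have hkl : polyIntegral (legendre L * endpointKernel L) = 0 := by
      rw [endpointKernel, Finset.mul_sum, map_sum]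
      refine Finset.sum_eq_zero fun l hl => ?_
      rw [mul_left_comm, polyIntegral_C_mul, polyIntegral_legendre_mul_legendre,
        if_neg (Finset.mem_range.1 hl).ne']
      simp
    have h1 : polyIntegral (legendre L * q') = 0 := polyIntegral_legendre_mul_eq_zero L q' hdeg
    have hexp : q * endpointKernel (L + 1) = q' * endpointKernel L +
        C ((legendre L).eval 1) * (legendre L * q') + C c * (legendre L * endpointKernel L) +
        C (c * (legendre L).eval 1) * (legendre L * legendre L) := by
      rw [hker, hqq, C_mul]; ring
    rw [hexp, map_add, map_add, map_add, polyIntegral_C_mul, polyIntegral_C_mul,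
      polyIntegral_C_mul, h1, hkl, polyIntegral_legendre_mul_self, ih q' hdeg, hqq]
    simp

/-- The Nikolskii inequality at the endpoint: `p(1)² ≤ (L² / 2) ‖p‖²` for polynomials of degree
less than `L`. -/
theorem eval_one_sq_le (L : ℕ) (q : ℝ[X]) (hq : q.degree < L) :
    q.eval 1 ^ 2 ≤ (L : ℝ) ^ 2 / 2 * polyIntegral (q * q) := by
  have hK : (endpointKernel L).eval 1 = (L : ℝ) ^ 2 / 2 := by
    rw [endpointKernel, eval_finsetSum]
    simp only [eval_mul, eval_C, eval_one_legendre_mul_self]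
    clear hq
    induction L with
    | zero => simp
    | succ L ih => rw [Finset.sum_range_succ, ih]; push_cast; ring
  have hKdeg : (endpointKernel L).degree < L := by
    rw [endpointKernel]
    refine (degree_sum_le _ _).trans_lt ((Finset.sup_lt_iff (WithBot.bot_lt_coe _)).2 fun l hl => ?_)
    refine degree_le_natDegree.trans_lt ?_
    have h1 := (natDegree_C_mul_le ((legendre l).eval 1) (legendre l)).trans
      (natDegree_legendre_le l)
    have h2 := Finset.mem_range.1 hl
    exact_mod_cast h1.trans_lt h2
  have hKK := polyIntegral_mul_endpointKernel L _ hKdeg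
  have hqK := polyIntegral_mul_endpointKernel L q hq
  rw [hK] at hKK
  rcases Nat.eq_zero_or_pos L with rfl | hL
  · have : q = 0 := by
      rw [← degree_eq_bot]; exact Nat.WithBot.lt_zero_iff.1 (by simpa using hq)
    simp [this]
  · set m : ℝ := (L : ℝ) ^ 2 / 2 with hm
    have hmpos : 0 < m := by positivity
    -- nonnegativity of `‖m q - q(1) K‖²`, where `K` is the kernel and `‖K‖² = m`
    have hnn := polyIntegral_mul_self_nonneg (C m * q - C (q.eval 1) * endpointKernel L)
    have hexp : (C m * q - C (q.eval 1) * endpointKernel L) *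
        (C m * q - C (q.eval 1) * endpointKernel L) =
        C (m * m) * (q * q) + C (-(2 * m * q.eval 1)) * (q * endpointKernel L) +
        C (q.eval 1 * q.eval 1) * (endpointKernel L * endpointKernel L) := by
      simp only [C_mul, C_neg]
      have : (C (2 : ℝ)) = 2 := rfl
      rw [this]; ring
    rw [hexp, map_add, map_add, polyIntegral_C_mul, polyIntegral_C_mul, polyIntegral_C_mul,
      hqK, hKK] at hnn
    have : 0 ≤ m * (m * polyIntegral (q * q) - q.eval 1 ^ 2) := by nlinarith
    linarith [nonneg_of_mul_nonneg_right this hmpos]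

end Legendre

/-! ### The system `φ_k^{(r)} ⊗ φ_j` in `L₂(Q)` -/

theorem squareMeasure_eq_prod :
    squareMeasure = ((volume : Measure ℝ).restrict (Set.Icc (-1) 1)).prod
      ((volume : Measure ℝ).restrict (Set.Icc (-1) 1)) := by
  rw [Measure.prod_restrict]; rfl

theorem integral_restrict_Icc_eval_mul (p q : Polynomial ℝ) :
    ∫ t, p.eval t * q.eval t ∂((volume : Measure ℝ).restrict (Set.Icc (-1) 1)) =
      polyIntegral (p * q) := by
  rw [polyIntegral_apply, intervalIntegral.integral_of_le (by norm_num),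
    integral_Icc_eq_integral_Ioc]
  simp only [Polynomial.eval_mul]

theorem inner_legendreDeriv (r r' : ℕ) (i i' : ℕ × ℕ) :
    inner ℝ (legendreDeriv r i) (legendreDeriv r' i') =
      polyIntegral (Polynomial.derivative^[r] (legendre i.1) *
        Polynomial.derivative^[r'] (legendre i'.1)) * if i.2 = i'.2 then 1 else 0 := by
  rw [L2.inner_def, ← polyIntegral_legendre_mul_legendre]
  have h : (fun x => inner ℝ (legendreDeriv r i x) (legendreDeriv r' i' x)) =ᵐ[squareMeasure]
      fun x => ((Polynomial.derivative^[r] (legendre i.1)).eval x.1 *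
        (Polynomial.derivative^[r'] (legendre i'.1)).eval x.1) *
        ((legendre i.2).eval x.2 * (legendre i'.2).eval x.2) := by
    filter_upwards [(memLp_legendreDerivFun r i.1 i.2).coeFn_toLp,
      (memLp_legendreDerivFun r' i'.1 i'.2).coeFn_toLp] with x h1 h2
    rw [legendreDeriv, legendreDeriv, h1, h2]
    simp only [legendreDerivFun, RCLike.inner_apply, conj_trivial]
    ring
  rw [integral_congr_ae h, squareMeasure_eq_prod, integral_prod_mul (L := ℝ)
    (fun t => (Polynomial.derivative^[r] (legendre i.1)).eval t *
        (Polynomial.derivative^[r'] (legendre i'.1)).eval t)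
    (fun t => (legendre i.2).eval t * (legendre i'.2).eval t),
    integral_restrict_Icc_eval_mul, integral_restrict_Icc_eval_mul]

theorem coeff_legendreDeriv_zero (i i' : ℕ × ℕ) :
    coeff (legendreDeriv 0 i) i' = if i = i' then 1 else 0 := by
  rw [coeff, inner_legendreDeriv]
  simp only [Function.iterate_zero, id, polyIntegral_legendre_mul_legendre]
  by_cases h1 : i.1 = i'.1 <;> by_cases h2 : i.2 = i'.2 <;> simp [Prod.ext_iff, h1, h2]

theorem exists_norm_legendreDeriv_le (r : ℕ) (hr : 1 ≤ r) :
    ∃ C : ℝ, 0 < C ∧ ∀ i : ℕ × ℕ, 1 ≤ i.1 →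
      ‖legendreDeriv r i‖ ≤ C * (i.1 : ℝ) ^ (2 * (r : ℝ) - 1 / 2) := by
  obtain ⟨C, hC, h⟩ := exists_polyIntegral_iterate_derivative_le r hr
  refine ⟨Real.sqrt C, Real.sqrt_pos.2 hC, fun i hi => ?_⟩
  have hi' : (0 : ℝ) < i.1 := by exact_mod_cast hi
  refine abs_le_of_sq_le_sq' ?_ (by positivity) |>.2
  rw [← real_inner_self_eq_norm_sq, inner_legendreDeriv, if_pos rfl, mul_one, mul_pow,
    Real.sq_sqrt hC.le, ← Real.rpow_natCast, ← Real.rpow_mul hi'.le]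
  refine (h i.1 hi).trans_eq ?_
  rw [← Real.rpow_natCast, Nat.cast_sub (by omega)]
  congr 2
  push_cast
  ring

/-- The triangle inequality in `k` combined with the orthogonality in `j`. -/
theorem exists_norm_sum_sq_le (r : ℕ) (hr : 1 ≤ r) :
    ∃ C : ℝ, 0 < C ∧ ∀ (T : Finset (ℕ × ℕ)) (a : ℕ × ℕ → ℝ), (∀ i ∈ T, 1 ≤ i.1) →
      ‖∑ i ∈ T, a i • legendreDeriv r i‖ ^ 2 ≤ C * ∑ j ∈ T.image Prod.snd,
        (∑ i ∈ T with i.2 = j, |a i| * (i.1 : ℝ) ^ (2 * (r : ℝ) - 1 / 2)) ^ 2 := by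
  obtain ⟨C, hC, h⟩ := exists_norm_legendreDeriv_le r hr
  refine ⟨C ^ 2, by positivity, fun T a hT => ?_⟩
  set m : ℕ × ℕ → ℝ := fun i => |a i| * (i.1 : ℝ) ^ (2 * (r : ℝ) - 1 / 2) with hm
  have hterm : ∀ i ∈ T, ∀ i' ∈ T,
      inner ℝ (a i • legendreDeriv r i) (a i' • legendreDeriv r i') ≤
        if i'.2 = i.2 then C ^ 2 * (m i * m i') else 0 := by
    intro i hi i' hi'
    split_ifs with hij
    · refine (real_inner_le_norm _ _).trans ?_
      rw [norm_smul, norm_smul, Real.norm_eq_abs, Real.norm_eq_abs]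
      calc _ ≤ (|a i| * (C * (i.1 : ℝ) ^ (2 * (r : ℝ) - 1 / 2))) *
            (|a i'| * (C * (i'.1 : ℝ) ^ (2 * (r : ℝ) - 1 / 2))) := by
            gcongr
            · exact h i (hT i hi)
            · exact h i' (hT i' hi')
        _ = _ := by simp only [hm]; ring
    · rw [real_inner_smul_left, real_inner_smul_right, inner_legendreDeriv,
        if_neg (fun h => hij h.symm)]
      simp
  rw [← real_inner_self_eq_norm_sq, sum_inner]
  calc _ = ∑ i ∈ T, ∑ i' ∈ T, inner ℝ (a i • legendreDeriv r i) (a i' • legendreDeriv r i') :=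
        Finset.sum_congr rfl fun i _ => inner_sum _ _ _
    _ ≤ ∑ i ∈ T, ∑ i' ∈ T, if i'.2 = i.2 then C ^ 2 * (m i * m i') else 0 :=
        Finset.sum_le_sum fun i hi => Finset.sum_le_sum fun i' hi' => hterm i hi i' hi'
    _ = ∑ j ∈ T.image Prod.snd, ∑ i ∈ T with i.2 = j, ∑ i' ∈ T,
          if i'.2 = i.2 then C ^ 2 * (m i * m i') else 0 :=
        (Finset.sum_fiberwise_of_maps_to (fun i hi => Finset.mem_image_of_mem _ hi) _).symm
    _ = _ := by
        rw [Finset.mul_sum]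
        refine Finset.sum_congr rfl fun j _ => ?_
        rw [pow_two (Finset.sum _ _), Finset.sum_mul_sum, Finset.mul_sum]
        refine Finset.sum_congr rfl fun i hi => ?_
        rw [(Finset.mem_filter.1 hi).2, ← Finset.sum_filter, Finset.mul_sum]

/-- A lower bound for sums of `φ_k^{(r)} ⊗ φ_0` without cancellation, by evaluation at `t = 1`,
where all `φ_k^{(r)}` are positive. -/
theorem exists_le_norm_sum_legendreDeriv (r : ℕ) (hr : 1 ≤ r) :
    ∃ c : ℝ, 0 < c ∧ ∀ (M : ℕ) (S : Finset ℕ), 1 ≤ M → (∀ k ∈ S, 2 * r * M ≤ k) →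
      (∀ k ∈ S, k < 6 * r * M) → M ≤ S.card →
        c * (M : ℝ) ^ (2 * (r : ℝ) + 1 / 2) ≤ ‖∑ k ∈ S, legendreDeriv r (k, 0)‖ := by
  set b : ℝ := ((r.factorial : ℝ) * 4 ^ r)⁻¹ with hb
  have hbpos : 0 < b := by positivity
  have hr' : (0 : ℝ) < r := by exact_mod_cast hr
  refine ⟨b / (6 * r), by positivity, fun M S hM hS1 hS2 hcard => ?_⟩
  have hM' : (0 : ℝ) < M := by exact_mod_cast hM
  set P : Polynomial ℝ := ∑ k ∈ S, Polynomial.derivative^[r] (legendre k) with hP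
  have hnorm : ‖∑ k ∈ S, legendreDeriv r (k, 0)‖ ^ 2 = polyIntegral (P * P) := by
    rw [← real_inner_self_eq_norm_sq, sum_inner, hP, Finset.sum_mul, map_sum]
    refine Finset.sum_congr rfl fun k _ => ?_
    rw [inner_sum, Finset.mul_sum, map_sum]
    refine Finset.sum_congr rfl fun k' _ => ?_
    rw [inner_legendreDeriv]; simp
  have hdeg : P.degree < (6 * r * M : ℕ) := by
    refine (Polynomial.degree_sum_le _ _).trans_lt
      ((Finset.sup_lt_iff (WithBot.bot_lt_coe _)).2 fun k hk => ?_)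
    refine Polynomial.degree_le_natDegree.trans_lt ?_
    have h1 := Polynomial.natDegree_iterate_derivative (legendre k) r
    have h2 := natDegree_legendre_le k
    have h3 := hS2 k hk
    exact_mod_cast (by omega : (Polynomial.derivative^[r] (legendre k)).natDegree < 6 * r * M)
  have hval : b * (M : ℝ) ^ (2 * (r : ℝ) + 1 / 2) * M ≤ P.eval 1 := by
    rw [hP, Polynomial.eval_finsetSum]
    calc _ ≤ (S.card : ℝ) * (b * (M : ℝ) ^ (2 * (r : ℝ) + 1 / 2)) := by
          rw [mul_comm]
          gcongr
      _ = ∑ _k ∈ S, b * (M : ℝ) ^ (2 * (r : ℝ) + 1 / 2) := by simp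
      _ ≤ _ := by
          refine Finset.sum_le_sum fun k hk => ?_
          have hk1 := hS1 k hk
          have hrM : 1 ≤ r * M := Nat.mul_pos hr hM
          have hMk : M ≤ k := by nlinarith
          have hMk' : (M : ℝ) ≤ k := by exact_mod_cast hMk
          refine le_trans ?_ (le_eval_one_iterate_derivative_legendre k r hr (by nlinarith))
          have he : (M : ℝ) ^ (2 * (r : ℝ) + 1 / 2) = Real.sqrt M * (M : ℝ) ^ (2 * r) := by
            rw [Real.rpow_add hM', Real.sqrt_eq_rpow, mul_comm]
            congr 1
            rw [← Real.rpow_natCast]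
            push_cast
            rfl
          rw [he]
          gcongr
  have hmain := eval_one_sq_le _ P hdeg
  rw [← hnorm] at hmain
  push_cast at hmain
  have hN0 := norm_nonneg (∑ k ∈ S, legendreDeriv r (k, 0))
  set W := ‖∑ k ∈ S, legendreDeriv r (k, 0)‖
  have h1 : P.eval 1 ≤ 6 * r * M * W := by
    refine abs_le_of_sq_le_sq' (hmain.trans ?_) (by positivity) |>.2
    rw [mul_pow]
    nlinarith [mul_nonneg (sq_nonneg (6 * (r : ℝ) * M)) (sq_nonneg W)]
  have h2 := hval.trans h1
  have h3 : b * (M : ℝ) ^ (2 * (r : ℝ) + 1 / 2) ≤ 6 * r * W := by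
    refine le_of_mul_le_mul_right ?_ hM'
    linarith
  rw [div_mul_eq_mul_div, div_le_iff₀ (by positivity)]
  linarith

/-! ### Sums of powers and Hölder estimates -/

/-- The comparison of `k^{-1-α}` with its integral, as a telescoping difference. -/
theorem rpow_neg_one_add_le_sub {α : ℝ} (hα : 0 < α) {k : ℝ} (hk : 0 < k) :
    (k + 1) ^ (-(1 + α)) ≤ (k ^ (-α) - (k + 1) ^ (-α)) / α := by
  have h1 : 0 < k + 1 := by linarith
  have h2 : 1 + α / (k + 1) ≤ (k / (k + 1)) ^ (-α) := by
    rw [Real.rpow_def_of_pos (by positivity)]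
    refine le_trans ?_ (Real.add_one_le_exp _)
    have h3 := Real.log_le_sub_one_of_pos (show 0 < k / (k + 1) by positivity)
    have h4 : k / (k + 1) - 1 = -(1 / (k + 1)) := by field_simp; ring
    rw [h4] at h3
    have h5 : α / (k + 1) = α * (1 / (k + 1)) := by ring
    rw [h5]
    nlinarith
  rw [Real.div_rpow hk.le h1.le, le_div_iff₀ (by positivity)] at h2
  have h6 : (k + 1) ^ (-(1 + α)) = (k + 1) ^ (-α) / (k + 1) := by
    rw [show -(1 + α) = -α - 1 by ring, Real.rpow_sub_one h1.ne']
  rw [h6, le_div_iff₀ hα]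
  have h7 : (k + 1) ^ (-α) / (k + 1) * α = α / (k + 1) * (k + 1) ^ (-α) := by ring
  linarith

theorem sum_Ico_rpow_le {α : ℝ} (hα : 0 < α) (m n : ℕ) (hm : 1 ≤ m) :
    ∑ k ∈ Finset.Ico m (m + n), (k : ℝ) ^ (-(1 + α)) ≤ (1 + 1 / α) * (m : ℝ) ^ (-α) := by
  have hm' : (1 : ℝ) ≤ m := by exact_mod_cast hm
  have key : ∀ n : ℕ, ∑ k ∈ Finset.Ico m (m + (n + 1)), (k : ℝ) ^ (-(1 + α)) ≤
      (m : ℝ) ^ (-(1 + α)) + ((m : ℝ) ^ (-α) - ((m + n : ℕ) : ℝ) ^ (-α)) / α := by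
    intro n
    induction n with
    | zero => simp
    | succ n ih =>
      rw [← add_assoc m (n + 1) 1, Finset.sum_Ico_succ_top (by omega)]
      have h := rpow_neg_one_add_le_sub hα (show (0 : ℝ) < ((m + n : ℕ) : ℝ) by
        exact_mod_cast (by omega : 0 < m + n))
      have hc : ((m + (n + 1) : ℕ) : ℝ) = ((m + n : ℕ) : ℝ) + 1 := by push_cast; ring
      rw [hc]
      rw [sub_div] at h ih ⊢
      linarith
  have hsub : ∑ k ∈ Finset.Ico m (m + n), (k : ℝ) ^ (-(1 + α)) ≤
      ∑ k ∈ Finset.Ico m (m + (n + 1)), (k : ℝ) ^ (-(1 + α)) :=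
    Finset.sum_le_sum_of_subset_of_nonneg (Finset.Ico_subset_Ico_right (by omega))
      fun k _ _ => by positivity
  refine (hsub.trans (key n)).trans ?_
  have h1 : (m : ℝ) ^ (-(1 + α)) ≤ (m : ℝ) ^ (-α) :=
    Real.rpow_le_rpow_of_exponent_le hm' (by linarith)
  have h2 : 0 ≤ ((m + n : ℕ) : ℝ) ^ (-α) / α := by positivity
  have h3 : (1 + 1 / α) * (m : ℝ) ^ (-α) = (m : ℝ) ^ (-α) + (m : ℝ) ^ (-α) / α := by ring
  rw [sub_div, h3]
  linarith

theorem sum_rpow_le_of_lt {α : ℝ} (hα : 0 < α) {x : ℝ} (hx : 0 < x) (U : Finset ℕ)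
    (hU : ∀ k ∈ U, x < k) :
    ∑ k ∈ U, (k : ℝ) ^ (-(1 + α)) ≤ (1 + 1 / α) * x ^ (-α) := by
  set m := ⌊x⌋₊ + 1 with hm
  have hsub : U ⊆ Finset.Ico m (m + (U.sup id + 1)) := by
    intro k hk
    have h1 : ⌊x⌋₊ < k := (Nat.floor_lt hx.le).2 (hU k hk)
    have h2 : k ≤ U.sup id := Finset.le_sup (f := id) hk
    rw [Finset.mem_Ico]
    omega
  refine (Finset.sum_le_sum_of_subset_of_nonneg hsub fun k _ _ => by positivity).trans
    ((sum_Ico_rpow_le hα m _ (by omega)).trans ?_)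
  have hxm : x ≤ (m : ℝ) := by rw [hm]; push_cast; exact (Nat.lt_floor_add_one x).le
  exact mul_le_mul_of_nonneg_left (Real.rpow_le_rpow_of_nonpos hx hxm (by linarith))
    (by positivity)

/-- Hölder's inequality for the tail of a series. -/
theorem exists_sum_mul_rpow_le {s β : ℝ} (hs : 1 < s) (hβ : 0 < β) (μ : ℝ) :
    ∃ C : ℝ, 0 < C ∧ ∀ (x : ℝ), 0 < x → ∀ (ι : Type) (U : Finset ι) (κ : ι → ℕ) (a : ι → ℝ),
      Set.InjOn κ U → (∀ i ∈ U, x < κ i) →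
      ∑ i ∈ U, |a i| * (κ i : ℝ) ^ (μ - β - 1 + 1 / s) ≤
        C * x ^ (-β) * (∑ i ∈ U, (κ i : ℝ) ^ (s * μ) * |a i| ^ s) ^ (1 / s) := by
  have hs0 : 0 < s := by linarith
  set q : ℝ := s / (s - 1) with hq
  have hq0 : 0 < q := div_pos hs0 (by linarith)
  have hpq : s.HolderConjugate q := Real.HolderConjugate.conjExponent hs
  have hq1 : 1 / q = 1 - 1 / s := by rw [hq]; field_simp
  have hα : 0 < β * q := by positivity
  refine ⟨(1 + 1 / (β * q)) ^ (1 / q), by positivity, fun x hx ι U κ a hinj hU => ?_⟩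
  have hκ : ∀ i ∈ U, (0 : ℝ) < κ i := fun i hi => hx.trans (hU i hi)
  have hH := Real.inner_le_Lp_mul_Lq_of_nonneg U (f := fun i => (κ i : ℝ) ^ μ * |a i|)
    (g := fun i => (κ i : ℝ) ^ (-β - 1 / q)) hpq (fun i _ => by positivity)
    (fun i _ => by positivity)
  have hL : ∑ i ∈ U, |a i| * (κ i : ℝ) ^ (μ - β - 1 + 1 / s) =
      ∑ i ∈ U, (κ i : ℝ) ^ μ * |a i| * (κ i : ℝ) ^ (-β - 1 / q) := by
    refine Finset.sum_congr rfl fun i hi => ?_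
    rw [mul_right_comm, ← Real.rpow_add (hκ i hi), hq1, mul_comm]
    congr 2
    ring
  have h1 : ∑ i ∈ U, ((κ i : ℝ) ^ μ * |a i|) ^ s = ∑ i ∈ U, (κ i : ℝ) ^ (s * μ) * |a i| ^ s := by
    refine Finset.sum_congr rfl fun i hi => ?_
    rw [Real.mul_rpow (by positivity) (abs_nonneg _), ← Real.rpow_mul (hκ i hi).le, mul_comm μ]
  have h2 : ∑ i ∈ U, ((κ i : ℝ) ^ (-β - 1 / q)) ^ q ≤ (1 + 1 / (β * q)) * x ^ (-(β * q)) := by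
    have h3 : ∑ i ∈ U, ((κ i : ℝ) ^ (-β - 1 / q)) ^ q =
        ∑ k ∈ U.image κ, (k : ℝ) ^ (-(1 + β * q)) := by
      rw [Finset.sum_image hinj]
      refine Finset.sum_congr rfl fun i hi => ?_
      rw [← Real.rpow_mul (hκ i hi).le]
      congr 1
      field_simp
      ring
    rw [h3]
    refine sum_rpow_le_of_lt hα hx _ fun k hk => ?_
    obtain ⟨i, hi, rfl⟩ := Finset.mem_image.1 hk
    exact hU i hi
  rw [hL]
  refine hH.trans ?_
  rw [h1, mul_comm]
  refine mul_le_mul_of_nonneg_right ?_ (by positivity)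
  refine (Real.rpow_le_rpow (Finset.sum_nonneg fun i _ => by positivity) h2
    (by positivity)).trans_eq ?_
  rw [Real.mul_rpow (by positivity) (by positivity), ← Real.rpow_mul hx.le]
  congr 2
  field_simp

theorem summable_max_one_rpow {q : ℝ} (hq : 1 < q) :
    Summable fun j : ℕ => (max 1 (j : ℝ)) ^ (-q) := by
  rw [← summable_nat_add_iff 1]
  have h := (summable_nat_add_iff 1).2 (Real.summable_nat_rpow.2 (show -q < -1 by linarith))
  refine h.congr fun j => ?_
  rw [max_eq_right]
  push_cast
  linarith [(Nat.cast_nonneg j : (0 : ℝ) ≤ j)]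

/-- Hölder's inequality with exponents `s/2` and `s/(s-2)`, in a form that includes `s = 2`. -/
theorem exists_sum_mul_max_one_rpow_sq_le {s η : ℝ} (hs : 2 ≤ s) (hη : 1 / 2 - 1 / s < η) :
    ∃ C : ℝ, 0 < C ∧ ∀ (V : Finset ℕ) (B : ℕ → ℝ), (∀ j, 0 ≤ B j) → ∑ j ∈ V, B j ^ s ≤ 1 →
      ∑ j ∈ V, (B j * (max 1 (j : ℝ)) ^ (-η)) ^ 2 ≤ C := by
  have hs0 : 0 < s := by linarith
  have hη0 : 0 < η := by
    have : 1 / s ≤ 1 / 2 := one_div_le_one_div_of_le (by norm_num) hs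
    linarith
  rcases hs.eq_or_lt with rfl | hs2
  · refine ⟨1, one_pos, fun V B hB hV => (Finset.sum_le_sum fun j _ => ?_).trans hV⟩
    rw [mul_pow, Real.rpow_two]
    have h1 : (max 1 (j : ℝ)) ^ (-η) ≤ 1 :=
      Real.rpow_le_one_of_one_le_of_nonpos (le_max_left _ _) (by linarith)
    exact mul_le_of_le_one_right (sq_nonneg _) (pow_le_one₀ (by positivity) h1)
  · have hs2' : 0 < s - 2 := by linarith
    set q : ℝ := 2 * η * (s / (s - 2)) with hq
    have hq1 : 1 < q := by
      have h1 : 1 / 2 - 1 / s = (s - 2) / (2 * s) := by field_simp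
      rw [h1, div_lt_iff₀ (by positivity)] at hη
      rw [hq, ← mul_div_assoc, lt_div_iff₀ hs2']
      linarith
    have hsum := summable_max_one_rpow hq1
    refine ⟨1 + ∑' j : ℕ, (max 1 (j : ℝ)) ^ (-q),
      add_pos_of_pos_of_nonneg one_pos (tsum_nonneg fun j => by positivity),
      fun V B hB hV => ?_⟩
    refine le_trans (Finset.sum_le_sum (g := fun j => B j ^ s + (max 1 (j : ℝ)) ^ (-q))
      fun j _ => ?_) ?_
    · set J := max 1 (j : ℝ)
      have hJ : 0 < J := lt_max_of_lt_left one_pos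
      -- compare `B j` with the balancing value `J ^ (-2 η / (s - 2))`
      set t := J ^ (-(2 * η / (s - 2))) with ht
      have htpos : 0 < t := by positivity
      have hw : (J ^ (-η)) ^ 2 = t ^ (s - 2) := by
        rw [ht, ← Real.rpow_mul hJ.le, ← Real.rpow_natCast, ← Real.rpow_mul hJ.le]
        congr 1
        push_cast
        field_simp
      have hts : J ^ (-q) = t ^ s := by
        rw [ht, ← Real.rpow_mul hJ.le]
        congr 1
        rw [hq]
        field_simp
      have hsplit : ∀ y : ℝ, 0 < y → y ^ s = y ^ 2 * y ^ (s - 2) := by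
        intro y hy
        rw [← Real.rpow_two, ← Real.rpow_add hy]
        congr 1; ring
      rw [mul_pow, hw, hts]
      rcases le_total t (B j) with h | h
      · have hBpos := htpos.trans_le h
        have h1 : B j ^ 2 * t ^ (s - 2) ≤ B j ^ s := by
          rw [hsplit _ hBpos]
          gcongr
        have h2 : 0 ≤ t ^ s := by positivity
        linarith
      · have h1 : B j ^ 2 * t ^ (s - 2) ≤ t ^ s := by
          rw [hsplit _ htpos]
          gcongr
          exact hB j
        have h2 : 0 ≤ B j ^ s := Real.rpow_nonneg (hB j) _
        linarith
    · rw [Finset.sum_add_distrib]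
      exact add_le_add hV (hsum.sum_le_tsum V fun j _ => by positivity)

/-- The power mean inequality in the `ℓ_p` spaces, `1 ≤ p ≤ ∞`. -/
theorem sum_abs_le_rpow_mul_norm {ι : Type*} {p : ℝ≥0∞} (hp : 1 ≤ p) (ξ : lp (fun _ : ι => ℝ) p)
    (U : Finset ι) {K : ℝ} (hK : (U.card : ℝ) ≤ K) :
    ∑ i ∈ U, |ξ i| ≤ K ^ (1 - (p⁻¹).toReal) * ‖ξ‖ := by
  have hp0 : p ≠ 0 := (zero_lt_one.trans_le hp).ne'
  have hK0 : 0 ≤ K := (Nat.cast_nonneg _).trans hK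
  rcases eq_or_ne p ⊤ with rfl | hpt
  · calc ∑ i ∈ U, |ξ i| ≤ ∑ _i ∈ U, ‖ξ‖ :=
          Finset.sum_le_sum fun i _ => lp.norm_apply_le_norm hp0 ξ i
      _ = U.card * ‖ξ‖ := by simp
      _ ≤ _ := by
          simp only [ENNReal.inv_top, ENNReal.toReal_zero, sub_zero, Real.rpow_one]
          exact mul_le_mul_of_nonneg_right hK (lp.norm_nonneg' ξ)
  · have hq1 : 1 ≤ p.toReal := by
      rw [← ENNReal.toReal_one]; exact ENNReal.toReal_mono hpt hp
    have hq0 : 0 < p.toReal := by linarith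
    have hn : 0 ≤ ‖ξ‖ := lp.norm_nonneg' ξ
    have h1 := Real.rpow_sum_le_const_mul_sum_rpow U (fun i => ξ i) hq1
    have h2 := lp.sum_rpow_le_norm_rpow hq0 ξ U
    have h3 : (∑ i ∈ U, |ξ i|) ^ p.toReal ≤ (K ^ (1 - (p⁻¹).toReal) * ‖ξ‖) ^ p.toReal := by
      refine h1.trans ?_
      rw [Real.mul_rpow (by positivity) hn, ← Real.rpow_mul hK0, ENNReal.toReal_inv]
      have he : (1 - p.toReal⁻¹) * p.toReal = p.toReal - 1 := by field_simp
      rw [he]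
      refine mul_le_mul (Real.rpow_le_rpow (Nat.cast_nonneg _) hK (by linarith)) h2
        (Finset.sum_nonneg fun i _ => by positivity) (by positivity)
    exact (Real.rpow_le_rpow_iff (Finset.sum_nonneg fun i _ => abs_nonneg _) (by positivity)
      hq0).1 h3

/-! ### The error of the truncation method -/

/-- The part of the series outside the hyperbolic cross `k max(1, j)^γ ≤ n` has norm of order
`n^{-β}` on the unit ball of the class. -/
theorem exists_norm_tail_le {r : ℕ} (hr : 1 ≤ r) {s μ₁ μ₂ γ : ℝ} (hs : 2 ≤ s)
    (hβ : 0 < accExp r s μ₁) (hγ : 1 ≤ γ) (hγβ : γ * accExp r s μ₁ < μ₂ + 1 / s - 1 / 2) :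
    ∃ C : ℝ, 0 < C ∧ ∀ (n : ℕ) (T : Finset (ℕ × ℕ)) (a : ℕ × ℕ → ℝ),
      (∀ i ∈ T, 1 ≤ i.1 ∧ (n : ℝ) < i.1 * (max 1 (i.2 : ℝ)) ^ γ) →
      ∑ i ∈ T, (max 1 (i.1 : ℝ)) ^ (s * μ₁) * (max 1 (i.2 : ℝ)) ^ (s * μ₂) * |a i| ^ s ≤ 1 →
      ‖∑ i ∈ T, a i • legendreDeriv r i‖ ≤ C * ((n : ℝ) + 1) ^ (-accExp r s μ₁) := by
  set β := accExp r s μ₁ with hβdef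
  have hs0 : 0 < s := by linarith
  obtain ⟨C₁, hC₁, h₁⟩ := exists_norm_sum_sq_le r hr
  obtain ⟨C₂, hC₂, h₂⟩ := exists_sum_mul_rpow_le (by linarith : 1 < s) hβ μ₁
  obtain ⟨C₃, hC₃, h₃⟩ := exists_sum_mul_max_one_rpow_sq_le (s := s) (η := μ₂ - γ * β) hs
    (by linarith)
  have hexp : 2 * (r : ℝ) - 1 / 2 = μ₁ - β - 1 + 1 / s := by rw [hβdef, accExp]; ring
  refine ⟨Real.sqrt (C₁ * C₃) * (C₂ * 2 ^ β), by positivity, fun n T a hT hsum => ?_⟩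
  set B : ℕ → ℝ := fun j => (∑ i ∈ T with i.2 = j,
    (max 1 (i.1 : ℝ)) ^ (s * μ₁) * (max 1 (i.2 : ℝ)) ^ (s * μ₂) * |a i| ^ s) ^ (1 / s) with hB
  have hB0 : ∀ j, 0 ≤ B j := fun j => by positivity
  have hBs : ∑ j ∈ T.image Prod.snd, B j ^ s ≤ 1 := by
    refine le_trans (le_of_eq ?_) hsum
    rw [← Finset.sum_fiberwise_of_maps_to (g := Prod.snd) (t := T.image Prod.snd)
      (fun i hi => Finset.mem_image_of_mem _ hi)]
    refine Finset.sum_congr rfl fun j _ => ?_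
    rw [hB, ← Real.rpow_mul (Finset.sum_nonneg fun i _ => by positivity),
      one_div_mul_cancel hs0.ne', Real.rpow_one]
  have hrow : ∀ j, ∑ i ∈ T with i.2 = j, |a i| * (i.1 : ℝ) ^ (2 * (r : ℝ) - 1 / 2) ≤
      C₂ * 2 ^ β * ((n : ℝ) + 1) ^ (-β) * (B j * (max 1 (j : ℝ)) ^ (-(μ₂ - γ * β))) := by
    intro j
    set J := max 1 (j : ℝ) with hJ
    have hJ1 : 1 ≤ J := le_max_left _ _
    have hJ0 : 0 < J := by linarith
    have hx : 0 < ((n : ℝ) + 1) / (2 * J ^ γ) := by positivity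
    have hmem : ∀ i ∈ T.filter (fun i => i.2 = j), i ∈ T ∧ i.2 = j := fun i hi =>
      Finset.mem_filter.1 hi
    -- `k J^γ > n` and `k J^γ ≥ 1` give `k > (n + 1) / (2 J^γ)`, which is positive even for `n = 0`
    have hH := h₂ _ hx (ℕ × ℕ) (T.filter fun i => i.2 = j) Prod.fst a
      (fun i hi i' hi' h => Prod.ext h ((hmem i hi).2.trans (hmem i' hi').2.symm))
      (fun i hi => by
        obtain ⟨hiT, rfl⟩ := hmem i hi
        obtain ⟨h1, h2⟩ := hT i hiT
        have h1' : (1 : ℝ) ≤ i.1 := by exact_mod_cast h1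
        have h3 : 1 ≤ J ^ γ := Real.one_le_rpow hJ1 (by linarith)
        rw [div_lt_iff₀ (by positivity)]
        nlinarith)
    rw [hexp]
    refine hH.trans_eq ?_
    have hBj : B j = J ^ μ₂ *
        (∑ i ∈ T with i.2 = j, (i.1 : ℝ) ^ (s * μ₁) * |a i| ^ s) ^ (1 / s) := by
      have h1 : ∑ i ∈ T with i.2 = j,
          (max 1 (i.1 : ℝ)) ^ (s * μ₁) * (max 1 (i.2 : ℝ)) ^ (s * μ₂) * |a i| ^ s =
          J ^ (s * μ₂) * ∑ i ∈ T with i.2 = j, (i.1 : ℝ) ^ (s * μ₁) * |a i| ^ s := by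
        rw [Finset.mul_sum]
        refine Finset.sum_congr rfl fun i hi => ?_
        obtain ⟨hiT, hij⟩ := hmem i hi
        have h1' : (1 : ℝ) ≤ i.1 := by exact_mod_cast (hT i hiT).1
        rw [max_eq_right h1', hij]
        ring
      simp only [hB]
      rw [h1, Real.mul_rpow (by positivity) (Finset.sum_nonneg fun i _ => by positivity),
        ← Real.rpow_mul hJ0.le]
      congr 2
      field_simp
    have hxβ : (((n : ℝ) + 1) / (2 * J ^ γ)) ^ (-β) =
        2 ^ β * ((n : ℝ) + 1) ^ (-β) * J ^ (γ * β) := by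
      rw [Real.div_rpow (by positivity) (by positivity),
        Real.mul_rpow (by norm_num) (by positivity), ← Real.rpow_mul hJ0.le,
        Real.rpow_neg (by norm_num : (0 : ℝ) ≤ 2), mul_neg, Real.rpow_neg hJ0.le]
      field_simp
    have hJJ : J ^ μ₂ * J ^ (-(μ₂ - γ * β)) = J ^ (γ * β) := by
      rw [← Real.rpow_add hJ0]
      congr 1; ring
    rw [hBj, hxβ, ← hJJ]
    ring
  have hN : 0 < ((n : ℝ) + 1) ^ (-β) := by positivity
  refine abs_le_of_sq_le_sq' ?_ (by positivity) |>.2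
  calc _ ≤ C₁ * ∑ j ∈ T.image Prod.snd,
        (∑ i ∈ T with i.2 = j, |a i| * (i.1 : ℝ) ^ (2 * (r : ℝ) - 1 / 2)) ^ 2 :=
        h₁ T a fun i hi => (hT i hi).1
    _ ≤ C₁ * ∑ j ∈ T.image Prod.snd, (C₂ * 2 ^ β * ((n : ℝ) + 1) ^ (-β)) ^ 2 *
        (B j * (max 1 (j : ℝ)) ^ (-(μ₂ - γ * β))) ^ 2 := by
        refine mul_le_mul_of_nonneg_left (Finset.sum_le_sum fun j _ => ?_) hC₁.le
        rw [← mul_pow]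
        exact pow_le_pow_left₀ (Finset.sum_nonneg fun i _ => by positivity) (hrow j) 2
    _ ≤ C₁ * ((C₂ * 2 ^ β * ((n : ℝ) + 1) ^ (-β)) ^ 2 * C₃) := by
        rw [← Finset.mul_sum]
        gcongr
        exact h₃ _ B hB0 hBs
    _ = _ := by
        have hsq := Real.sq_sqrt (show 0 ≤ C₁ * C₃ by positivity)
        linear_combination (-(C₂ * 2 ^ β * ((n : ℝ) + 1) ^ (-β)) ^ 2) * hsq

/-- The noise on the hyperbolic cross is amplified by the factor `n^{2r + 1/2 - 1/p}` at most. -/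
theorem exists_norm_noise_le {r : ℕ} (hr : 1 ≤ r) {γ : ℝ} (hγ : 1 ≤ γ) {p : ℝ≥0∞} (hp : 1 ≤ p) :
    ∃ C : ℝ, 0 < C ∧ ∀ (n : ℕ) (T : Finset (ℕ × ℕ)) (ξ : lp (fun _ : ℕ × ℕ => ℝ) p),
      (∀ i ∈ T, 1 ≤ i.1 ∧ i.1 * (max 1 (i.2 : ℝ)) ^ γ ≤ n) →
      ‖∑ i ∈ T, ξ i • legendreDeriv r i‖ ≤
        C * ‖ξ‖ * (n : ℝ) ^ (2 * (r : ℝ) + 1 / 2 - (p⁻¹).toReal) := by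
  obtain ⟨C₁, hC₁, h₁⟩ := exists_norm_sum_sq_le r hr
  have hr' : (1 : ℝ) ≤ r := by exact_mod_cast hr
  have hp1 : (p⁻¹).toReal ≤ 1 := by
    rw [← ENNReal.toReal_one]
    exact ENNReal.toReal_mono ENNReal.one_ne_top (ENNReal.inv_le_one.2 hp)
  set e : ℝ := 2 * (r : ℝ) + 1 / 2 - (p⁻¹).toReal with he
  have he1 : 1 ≤ e := by linarith
  set Z : ℝ := ∑' j : ℕ, (max 1 (j : ℝ)) ^ (-(2 : ℝ)) with hZ
  have hsum := summable_max_one_rpow (q := 2) (by norm_num)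
  have hZ0 : 0 ≤ Z := tsum_nonneg fun j => by positivity
  refine ⟨Real.sqrt (C₁ * (Z + 1)), by positivity, fun n T ξ hT => ?_⟩
  have hξ : 0 ≤ ‖ξ‖ := lp.norm_nonneg' ξ
  have hrow : ∀ j, ∑ i ∈ T with i.2 = j, |ξ i| * (i.1 : ℝ) ^ (2 * (r : ℝ) - 1 / 2) ≤
      ‖ξ‖ * (n : ℝ) ^ e * (max 1 (j : ℝ)) ^ (-(1 : ℝ)) := by
    intro j
    set J := max 1 (j : ℝ) with hJ
    have hJ1 : 1 ≤ J := le_max_left _ _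
    have hJ0 : 0 < J := by linarith
    set K : ℝ := n / J ^ γ with hK
    have hK0 : 0 ≤ K := by positivity
    have hmem : ∀ i ∈ T.filter (fun i => i.2 = j), i ∈ T ∧ i.2 = j := fun i hi =>
      Finset.mem_filter.1 hi
    have hle : ∀ i ∈ T.filter (fun i => i.2 = j), (i.1 : ℝ) ≤ K := by
      intro i hi
      obtain ⟨hiT, rfl⟩ := hmem i hi
      rw [hK, le_div_iff₀ (by positivity)]
      exact (hT i hiT).2
    have hcard : ((T.filter fun i => i.2 = j).card : ℝ) ≤ K := by
      have h1 : (T.filter fun i => i.2 = j).card ≤ (Finset.Icc 1 ⌊K⌋₊).card := by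
        refine Finset.card_le_card_of_injOn Prod.fst (fun i hi => ?_)
          (fun i hi i' hi' h => Prod.ext h ((hmem i hi).2.trans (hmem i' hi').2.symm))
        exact Finset.mem_coe.2 (Finset.mem_Icc.2 ⟨(hT i (hmem i hi).1).1, Nat.le_floor (hle i hi)⟩)
      rw [Nat.card_Icc, Nat.add_sub_cancel] at h1
      exact (Nat.cast_le.2 h1).trans (Nat.floor_le hK0)
    calc _ ≤ ∑ i ∈ T with i.2 = j, |ξ i| * K ^ (2 * (r : ℝ) - 1 / 2) := by
          refine Finset.sum_le_sum fun i hi => ?_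
          gcongr
          · linarith
          · exact hle i hi
      _ ≤ (K ^ (1 - (p⁻¹).toReal) * ‖ξ‖) * K ^ (2 * (r : ℝ) - 1 / 2) := by
          rw [← Finset.sum_mul]
          exact mul_le_mul_of_nonneg_right (sum_abs_le_rpow_mul_norm hp ξ _ hcard)
            (by positivity)
      _ = ‖ξ‖ * K ^ e := by
          have h2 : K ^ e = K ^ (1 - (p⁻¹).toReal) * K ^ (2 * (r : ℝ) - 1 / 2) := by
            rw [← Real.rpow_add_of_nonneg hK0 (by linarith) (by linarith), he]
            congr 1; ring
          rw [h2]; ring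
      _ ≤ _ := by
          rw [mul_assoc]
          refine mul_le_mul_of_nonneg_left ?_ hξ
          rw [hK, Real.div_rpow (by positivity) (by positivity), ← Real.rpow_mul hJ0.le,
            div_eq_mul_inv, ← Real.rpow_neg hJ0.le]
          refine mul_le_mul_of_nonneg_left (Real.rpow_le_rpow_of_exponent_le hJ1 ?_)
            (by positivity)
          nlinarith
  refine abs_le_of_sq_le_sq' ?_ (by positivity) |>.2
  calc _ ≤ C₁ * ∑ j ∈ T.image Prod.snd,
        (∑ i ∈ T with i.2 = j, |ξ i| * (i.1 : ℝ) ^ (2 * (r : ℝ) - 1 / 2)) ^ 2 :=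
        h₁ T _ fun i hi => (hT i hi).1
    _ ≤ C₁ * ∑ j ∈ T.image Prod.snd, (‖ξ‖ * (n : ℝ) ^ e) ^ 2 *
        (max 1 (j : ℝ)) ^ (-(2 : ℝ)) := by
        refine mul_le_mul_of_nonneg_left (Finset.sum_le_sum fun j _ => ?_) hC₁.le
        refine (pow_le_pow_left₀ (Finset.sum_nonneg fun i _ => by positivity)
          (hrow j) 2).trans_eq ?_
        rw [mul_pow _ ((max 1 (j : ℝ)) ^ (-(1 : ℝ)))]
        congr 1
        rw [← Real.rpow_natCast, ← Real.rpow_mul (by positivity)]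
        norm_num
    _ ≤ C₁ * ((‖ξ‖ * (n : ℝ) ^ e) ^ 2 * (Z + 1)) := by
        rw [← Finset.mul_sum]
        gcongr
        exact (hsum.sum_le_tsum _ fun j _ => by positivity).trans (by linarith)
    _ = _ := by
        rw [mul_assoc (Real.sqrt _), mul_pow (Real.sqrt _), Real.sq_sqrt (by positivity)]
        ring

/-- Once `j` is replaced by `max 1 j`, the conditions `k ≤ n` and `j ≤ (n/r)^{1/γ}` of the
definition follow from the others. For `j = 0` the condition `k ≤ n` is not redundant in the
definition, because `0 ^ γ = 0`. -/
theorem mem_hyperbolicCross {r n : ℕ} {γ : ℝ} (hr : 1 ≤ r) (hγ : 1 ≤ γ) (i : ℕ × ℕ) :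
    i ∈ hyperbolicCross r n γ ↔ r ≤ i.1 ∧ (i.1 : ℝ) * (max 1 (i.2 : ℝ)) ^ γ ≤ n := by
  have hγ0 : 0 < γ := by linarith
  have hr0 : (0 : ℝ) < r := by exact_mod_cast hr
  have hJ1 : 1 ≤ (max 1 (i.2 : ℝ)) ^ γ := Real.one_le_rpow (le_max_left _ _) hγ0.le
  have hi0 : (0 : ℝ) ≤ i.1 := Nat.cast_nonneg _
  simp only [hyperbolicCross, Finset.mem_filter, Finset.mem_product, Finset.mem_Icc, zero_le,
    true_and]
  constructor
  · rintro ⟨⟨⟨h1, h2⟩, -⟩, h3⟩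
    refine ⟨h1, ?_⟩
    rcases Nat.eq_zero_or_pos i.2 with h | h
    · simp only [h, Nat.cast_zero, max_eq_left zero_le_one, Real.one_rpow, mul_one]
      exact_mod_cast h2
    · rwa [max_eq_right (by exact_mod_cast h)]
  · rintro ⟨h1, h2⟩
    have h1' : (r : ℝ) ≤ i.1 := by exact_mod_cast h1
    refine ⟨⟨⟨h1, ?_⟩, ?_⟩, ?_⟩
    · have : (i.1 : ℝ) ≤ n := by nlinarith
      exact_mod_cast this
    · refine Nat.le_floor ?_
      refine (le_max_right 1 (i.2 : ℝ)).trans ?_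
      rw [one_div, Real.le_rpow_inv_iff_of_pos (by positivity) (by positivity) hγ0,
        le_div_iff₀ hr0]
      nlinarith
    · refine le_trans ?_ h2
      gcongr
      exact le_max_right _ _

theorem sum_le_of_smoothNorm_le {s μ₁ μ₂ M : ℝ} (hs : 0 < s) (hM : 0 ≤ M) {f : L2Q}
    (hf : smoothNorm s μ₁ μ₂ f ≤ ENNReal.ofReal M) (T : Finset (ℕ × ℕ)) :
    ∑ i ∈ T, (max 1 (i.1 : ℝ)) ^ (s * μ₁) * (max 1 (i.2 : ℝ)) ^ (s * μ₂) * |coeff f i| ^ s ≤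
      M ^ s := by
  have h1 := ENNReal.rpow_le_rpow hf hs.le
  rw [smoothNorm, ← ENNReal.rpow_mul, one_div_mul_cancel hs.ne', ENNReal.rpow_one,
    ENNReal.ofReal_rpow_of_nonneg hM hs.le] at h1
  have h2 := (ENNReal.sum_le_tsum T).trans h1
  rw [← ENNReal.ofReal_sum_of_nonneg fun i _ => by positivity] at h2
  exact (ENNReal.ofReal_le_ofReal_iff (by positivity)).1 h2

theorem sum_derivTerm_eq {r : ℕ} (f : L2Q) (t : Finset {i : ℕ × ℕ // r ≤ i.1}) :
    ∑ i ∈ t, derivTerm r f i =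
      ∑ i ∈ t.map (Function.Embedding.subtype _), coeff f i • legendreDeriv r i := by
  rw [Finset.sum_map]; rfl

/-- The tail estimate for `γ = 1` is a Cauchy criterion for the series of the derivative. -/
theorem summable_derivTerm {r : ℕ} (hr : 1 ≤ r) {s μ₁ μ₂ : ℝ} (hs : 2 ≤ s)
    (hβ : 0 < accExp r s μ₁) (hμ : accExp r s μ₁ < μ₂ + 1 / s - 1 / 2) {f : L2Q}
    (hf : smoothNorm s μ₁ μ₂ f < ⊤) : Summable (derivTerm r f) := by
  obtain ⟨C, hC, h⟩ := exists_norm_tail_le hr hs hβ le_rfl (by rwa [one_mul])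
  have hs0 : 0 < s := by linarith
  set M : ℝ := (smoothNorm s μ₁ μ₂ f).toReal + 1 with hM
  have hM0 : 0 < M := by positivity
  have hfM : smoothNorm s μ₁ μ₂ f ≤ ENNReal.ofReal M := by
    rw [← ENNReal.ofReal_toReal hf.ne]
    exact ENNReal.ofReal_le_ofReal (by linarith)
  have htail : ∀ (n : ℕ) (T : Finset (ℕ × ℕ)),
      (∀ i ∈ T, 1 ≤ i.1 ∧ (n : ℝ) < i.1 * (max 1 (i.2 : ℝ)) ^ (1 : ℝ)) →
      ‖∑ i ∈ T, coeff f i • legendreDeriv r i‖ ≤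
        M * (C * ((n : ℝ) + 1) ^ (-accExp r s μ₁)) := by
    intro n T hT
    have h1 := h n T (fun i => M⁻¹ * coeff f i) hT (by
      have h2 := sum_le_of_smoothNorm_le hs0 hM0.le hfM T
      have h3 : ∀ i ∈ T, (max 1 (i.1 : ℝ)) ^ (s * μ₁) * (max 1 (i.2 : ℝ)) ^ (s * μ₂) *
          |M⁻¹ * coeff f i| ^ s = (M ^ s)⁻¹ * ((max 1 (i.1 : ℝ)) ^ (s * μ₁) *
            (max 1 (i.2 : ℝ)) ^ (s * μ₂) * |coeff f i| ^ s) := by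
        intro i _
        rw [abs_mul, Real.mul_rpow (abs_nonneg _) (abs_nonneg _), abs_of_pos (inv_pos.2 hM0),
          Real.inv_rpow hM0.le]
        ring
      rw [Finset.sum_congr rfl h3, ← Finset.mul_sum, inv_mul_le_iff₀ (by positivity), mul_one]
      exact h2)
    have h4 : ∑ i ∈ T, coeff f i • legendreDeriv r i =
        M • ∑ i ∈ T, (M⁻¹ * coeff f i) • legendreDeriv r i := by
      rw [Finset.smul_sum]
      refine Finset.sum_congr rfl fun i _ => ?_
      rw [smul_smul, mul_inv_cancel_left₀ hM0.ne']
    rw [h4, norm_smul, Real.norm_of_nonneg hM0.le]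
    exact mul_le_mul_of_nonneg_left h1 hM0.le
  rw [summable_iff_vanishing_norm]
  intro ε hε
  have hlim : Filter.Tendsto (fun n : ℕ => M * (C * ((n : ℝ) + 1) ^ (-accExp r s μ₁)))
      Filter.atTop (nhds (M * (C * 0))) := by
    refine ((Filter.Tendsto.comp (tendsto_rpow_neg_atTop hβ) ?_).const_mul C).const_mul M
    exact Filter.tendsto_atTop_add_const_right _ _ tendsto_natCast_atTop_atTop
  rw [mul_zero, mul_zero] at hlim
  obtain ⟨n, hn⟩ := (hlim.eventually (gt_mem_nhds hε)).exists
  refine ⟨(hyperbolicCross r n 1).subtype _, fun t ht => ?_⟩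
  rw [sum_derivTerm_eq]
  refine (htail n _ fun i hi => ?_).trans_lt hn
  obtain ⟨i, hit, rfl⟩ := Finset.mem_map.1 hi
  refine ⟨hr.trans i.2, ?_⟩
  by_contra hcon
  have hmem : i ∈ (hyperbolicCross r n 1).subtype (fun i : ℕ × ℕ => r ≤ i.1) := by
    rw [Finset.mem_subtype]
    exact (mem_hyperbolicCross hr le_rfl _).2 ⟨i.2, not_lt.1 hcon⟩
  exact Finset.disjoint_left.1 ht hit hmem

/-- Bounds for all finite sums outside `Ω` pass to the sum of the series. -/
theorem norm_partialDeriv_sub_le {r : ℕ} {f : L2Q} (hf : Summable (derivTerm r f))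
    (Ω : Finset (ℕ × ℕ)) (hΩ : ∀ i ∈ Ω, r ≤ i.1) {B : ℝ}
    (hB : ∀ T : Finset (ℕ × ℕ), (∀ i ∈ T, r ≤ i.1 ∧ i ∉ Ω) →
      ‖∑ i ∈ T, coeff f i • legendreDeriv r i‖ ≤ B) :
    ‖partialDeriv r f - ∑ i ∈ Ω, coeff f i • legendreDeriv r i‖ ≤ B := by
  have h1 := (hf.hasSum.sub_const (∑ i ∈ Ω, coeff f i • legendreDeriv r i)).norm
  refine le_of_tendsto h1 ?_
  filter_upwards [Filter.eventually_ge_atTop (Ω.subtype fun i : ℕ × ℕ => r ≤ i.1)] with t ht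
  have hsub : Ω ⊆ t.map (Function.Embedding.subtype _) := by
    intro i hi
    exact Finset.mem_map.2 ⟨⟨i, hΩ i hi⟩, ht (Finset.mem_subtype.2 hi), rfl⟩
  rw [sum_derivTerm_eq, ← Finset.sum_sdiff hsub, add_sub_cancel_right]
  refine hB _ fun i hi => ?_
  obtain ⟨h2, h3⟩ := Finset.mem_sdiff.1 hi
  obtain ⟨i, -, rfl⟩ := Finset.mem_map.1 h2
  exact ⟨i.2, h3⟩

/-- The error of the truncation method is at most the sum of the truncation error and the
amplified noise. -/
theorem exists_truncError_le {r : ℕ} (hr : 1 ≤ r) {s μ₁ μ₂ γ : ℝ} (hs : 2 ≤ s)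
    (hβ : 0 < accExp r s μ₁) (hμ : accExp r s μ₁ < μ₂ + 1 / s - 1 / 2) (hγ : 1 ≤ γ)
    (hγβ : γ * accExp r s μ₁ < μ₂ + 1 / s - 1 / 2) {p : ℝ≥0∞} (hp : 1 ≤ p) :
    ∃ C : ℝ, 0 < C ∧ ∀ δ : ℝ, 0 < δ → ∀ n : ℕ,
      truncError r s μ₁ μ₂ p δ n γ ≤ ENNReal.ofReal (C * (((n : ℝ) + 1) ^ (-accExp r s μ₁) +
        δ * (n : ℝ) ^ (noiseExp s μ₁ p - accExp r s μ₁))) := by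
  obtain ⟨C₁, hC₁, h₁⟩ := exists_norm_tail_le hr hs hβ hγ hγβ
  obtain ⟨C₂, hC₂, h₂⟩ := exists_norm_noise_le hr hγ hp
  have he : 2 * (r : ℝ) + 1 / 2 - (p⁻¹).toReal = noiseExp s μ₁ p - accExp r s μ₁ := by
    rw [noiseExp, accExp]; ring
  rw [he] at h₂
  have hs0 : 0 < s := by linarith
  refine ⟨max C₁ C₂, lt_max_of_lt_left hC₁, fun δ hδ n => ?_⟩
  set Ω := hyperbolicCross r n γ with hΩ
  have hΩr : ∀ i ∈ Ω, r ≤ i.1 := fun i hi => ((mem_hyperbolicCross hr hγ i).1 hi).1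
  refine iSup_le fun f => iSup_le fun hf => iSup_le fun y => iSup_le fun hy => ?_
  obtain ⟨ξ, hξ, hξδ⟩ := hy
  rw [← ofReal_norm]
  refine ENNReal.ofReal_le_ofReal ?_
  have htail : ‖partialDeriv r f - ∑ i ∈ Ω, coeff f i • legendreDeriv r i‖ ≤
      C₁ * ((n : ℝ) + 1) ^ (-accExp r s μ₁) := by
    refine norm_partialDeriv_sub_le (summable_derivTerm hr hs hβ hμ
      (hf.trans_lt ENNReal.one_lt_top)) Ω hΩr fun T hT => h₁ n T _ (fun i hi => ?_) ?_
    · obtain ⟨h3, h4⟩ := hT i hi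
      refine ⟨hr.trans h3, ?_⟩
      by_contra hcon
      exact h4 ((mem_hyperbolicCross hr hγ i).2 ⟨h3, not_lt.1 hcon⟩)
    · refine (sum_le_of_smoothNorm_le hs0 zero_le_one (by simpa using hf) T).trans_eq ?_
      rw [Real.one_rpow]
  have hnoise : ‖∑ i ∈ Ω, ξ i • legendreDeriv r i‖ ≤
      C₂ * δ * (n : ℝ) ^ (noiseExp s μ₁ p - accExp r s μ₁) := by
    refine (h₂ n Ω ξ fun i hi => ?_).trans (by gcongr)
    obtain ⟨h3, h4⟩ := (mem_hyperbolicCross hr hγ i).1 hi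
    exact ⟨hr.trans h3, h4⟩
  have hsplit : partialDeriv r f - truncation r Ω (fun i => y i) =
      (partialDeriv r f - ∑ i ∈ Ω, coeff f i • legendreDeriv r i) +
        ∑ i ∈ Ω, ξ i • legendreDeriv r i := by
    have h5 : truncation r Ω (fun i => y i) = ∑ i ∈ Ω, y i • legendreDeriv r i :=
      Finset.sum_coe_sort Ω fun i => y i • legendreDeriv r i
    rw [h5, sub_add, ← Finset.sum_sub_distrib]
    congr 1
    refine Finset.sum_congr rfl fun i _ => ?_
    rw [hξ i, ← sub_smul]
    congr 1; ring
  rw [hsplit]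
  refine (norm_add_le _ _).trans ?_
  have h6 : C₁ * ((n : ℝ) + 1) ^ (-accExp r s μ₁) ≤
      max C₁ C₂ * ((n : ℝ) + 1) ^ (-accExp r s μ₁) := by gcongr; exact le_max_left _ _
  have h7 : C₂ * δ * (n : ℝ) ^ (noiseExp s μ₁ p - accExp r s μ₁) ≤
      max C₁ C₂ * (δ * (n : ℝ) ^ (noiseExp s μ₁ p - accExp r s μ₁)) := by
    rw [mul_assoc]; gcongr; exact le_max_right _ _
  rw [mul_add]
  linarith

/-! ### The size of the hyperbolic cross -/

/-- The row `j` of the hyperbolic cross has at most `n max(1, j)^{-γ}` points. -/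
theorem card_hyperbolicCross_le_sum {r : ℕ} (hr : 1 ≤ r) {γ : ℝ} (hγ : 1 ≤ γ) (n : ℕ) :
    ((hyperbolicCross r n γ).card : ℝ) ≤
      n * ∑ j ∈ (hyperbolicCross r n γ).image Prod.snd, (max 1 (j : ℝ)) ^ (-γ) := by
  set Γ := hyperbolicCross r n γ with hΓ
  rw [Finset.card_eq_sum_card_fiberwise (f := Prod.snd) (t := Γ.image Prod.snd)
    (fun i hi => Finset.mem_coe.2 (Finset.mem_image_of_mem _ hi)), Nat.cast_sum, Finset.mul_sum]
  refine Finset.sum_le_sum fun j _ => ?_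
  have hJ0 : 0 < max 1 (j : ℝ) := lt_max_of_lt_left one_pos
  rw [Real.rpow_neg hJ0.le, ← div_eq_mul_inv]
  set K : ℝ := n / (max 1 (j : ℝ)) ^ γ with hK
  have hK0 : 0 ≤ K := by positivity
  have h1 : (Γ.filter fun i => i.2 = j).card ≤ (Finset.Icc 1 ⌊K⌋₊).card := by
    refine Finset.card_le_card_of_injOn Prod.fst (fun i hi => ?_) (fun i hi i' hi' h =>
      Prod.ext h ((Finset.mem_filter.1 hi).2.trans (Finset.mem_filter.1 hi').2.symm))
    obtain ⟨hiT, rfl⟩ := Finset.mem_filter.1 hi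
    obtain ⟨h2, h3⟩ := (mem_hyperbolicCross hr hγ i).1 hiT
    refine Finset.mem_coe.2 (Finset.mem_Icc.2 ⟨hr.trans h2, Nat.le_floor ?_⟩)
    rwa [hK, le_div_iff₀ (by positivity)]
  rw [Nat.card_Icc, Nat.add_sub_cancel] at h1
  exact (Nat.cast_le.2 h1).trans (Nat.floor_le hK0)

theorem exists_card_hyperbolicCross_le {r : ℕ} (hr : 1 ≤ r) {γ : ℝ} (hγ : 1 < γ) :
    ∃ C : ℝ, 0 < C ∧ ∀ n : ℕ, ((hyperbolicCross r n γ).card : ℝ) ≤ C * n := by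
  have hsum := summable_max_one_rpow hγ
  have h0 : 0 ≤ ∑' j : ℕ, (max 1 (j : ℝ)) ^ (-γ) := tsum_nonneg fun j => by positivity
  refine ⟨∑' j : ℕ, (max 1 (j : ℝ)) ^ (-γ) + 1, by positivity, fun n => ?_⟩
  refine (card_hyperbolicCross_le_sum hr hγ.le n).trans ?_
  rw [mul_comm]
  gcongr
  exact (hsum.sum_le_tsum _ fun j _ => by positivity).trans (by linarith)

theorem card_hyperbolicCross_one_le {r : ℕ} (hr : 1 ≤ r) (n : ℕ) :
    ((hyperbolicCross r n 1).card : ℝ) ≤ n * (2 + Real.log n) := by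
  refine (card_hyperbolicCross_le_sum hr le_rfl n).trans ?_
  gcongr
  have hsub : (hyperbolicCross r n 1).image Prod.snd ⊆ Finset.range (n + 1) := by
    intro j hj
    obtain ⟨i, hi, rfl⟩ := Finset.mem_image.1 hj
    obtain ⟨h1, h2⟩ := (mem_hyperbolicCross hr le_rfl i).1 hi
    rw [Real.rpow_one] at h2
    have h3 : (1 : ℝ) ≤ i.1 := by exact_mod_cast hr.trans h1
    have h4 : (i.2 : ℝ) ≤ max 1 (i.2 : ℝ) := le_max_right _ _
    have h5 : (1 : ℝ) ≤ max 1 (i.2 : ℝ) := le_max_left _ _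
    have h6 : (i.2 : ℝ) ≤ n := by nlinarith
    rw [Finset.mem_range]
    exact Nat.lt_succ_of_le (by exact_mod_cast h6)
  refine (Finset.sum_le_sum_of_subset_of_nonneg hsub fun j _ _ => by positivity).trans ?_
  have h := harmonic_le_one_add_log n
  rw [harmonic] at h
  rw [Finset.sum_range_succ']
  have h7 : ∑ j ∈ Finset.range n, (max 1 ((j + 1 : ℕ) : ℝ)) ^ (-(1 : ℝ)) =
      ((∑ i ∈ Finset.range n, (↑(i + 1) : ℚ)⁻¹ : ℚ) : ℝ) := by
    push_cast
    refine Finset.sum_congr rfl fun j _ => ?_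
    rw [max_eq_right (by linarith [(Nat.cast_nonneg j : (0 : ℝ) ≤ j)]), Real.rpow_neg_one]
  rw [h7]
  have h8 : (max 1 ((0 : ℕ) : ℝ)) ^ (-(1 : ℝ)) = 1 := by simp
  rw [h8]
  linarith

/-! ### The lower bound for the minimal radius -/

theorem coeff_neg (f : L2Q) (i : ℕ × ℕ) : coeff (-f) i = -coeff f i := inner_neg_left _ _

theorem smoothNorm_neg (s μ₁ μ₂ : ℝ) (f : L2Q) :
    smoothNorm s μ₁ μ₂ (-f) = smoothNorm s μ₁ μ₂ f := by
  simp only [smoothNorm, coeff_neg, abs_neg]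

theorem partialDeriv_neg (r : ℕ) (f : L2Q) : partialDeriv r (-f) = -partialDeriv r f := by
  rw [partialDeriv, partialDeriv, ← tsum_neg]
  refine tsum_congr fun i => ?_
  rw [derivTerm, derivTerm, coeff_neg, neg_smul]

theorem isPerturbation_coeff {p : ℝ≥0∞} {δ : ℝ} (hδ : 0 ≤ δ) (f : L2Q) :
    IsPerturbation p δ f (coeff f) :=
  ⟨0, fun i => by simp, by simpa using hδ⟩

/-- If the information on `f` vanishes, no algorithm can tell `f` from `-f`. -/
theorem enorm_partialDeriv_le_algError {r : ℕ} {s μ₁ μ₂ : ℝ} {p : ℝ≥0∞} {δ : ℝ} (hδ : 0 ≤ δ)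
    {Ω : Finset (ℕ × ℕ)} (ψ : (Ω → ℝ) → L2Q) {f : L2Q} (hf : smoothNorm s μ₁ μ₂ f ≤ 1)
    (hΩ : ∀ i ∈ Ω, coeff f i = 0) :
    ‖partialDeriv r f‖ₑ ≤ algError r s μ₁ μ₂ p δ Ω ψ := by
  have key : ∀ g : L2Q, smoothNorm s μ₁ μ₂ g ≤ 1 → (∀ i ∈ Ω, coeff g i = 0) →
      ‖partialDeriv r g - ψ 0‖ₑ ≤ algError r s μ₁ μ₂ p δ Ω ψ := by
    intro g hg hgΩ
    have h0 : (fun i : Ω => coeff g i) = 0 := funext fun i => hgΩ i i.2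
    rw [← h0]
    exact le_iSup_of_le g (le_iSup_of_le hg (le_iSup_of_le (coeff g)
      (le_iSup_of_le (isPerturbation_coeff hδ g) le_rfl)))
  have h1 := key f hf hΩ
  have h2 := key (-f) ((smoothNorm_neg _ _ _ f).trans_le hf)
    (fun i hi => by rw [coeff_neg, hΩ i hi, neg_zero])
  rw [partialDeriv_neg] at h2
  rcases eq_or_ne (algError r s μ₁ μ₂ p δ Ω ψ) ⊤ with hE | hE
  · rw [hE]; exact le_top
  · have h3 := ENNReal.toReal_mono hE h1
    have h4 := ENNReal.toReal_mono hE h2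
    rw [toReal_enorm] at h3 h4
    rw [← ofReal_norm, ENNReal.ofReal_le_iff_le_toReal hE]
    have h5 := norm_sub_le (partialDeriv r f - ψ 0) (-partialDeriv r f - ψ 0)
    have h6 : partialDeriv r f - ψ 0 - (-partialDeriv r f - ψ 0) = (2 : ℝ) • partialDeriv r f := by
      rw [two_smul]; abel
    rw [h6, norm_smul, Real.norm_of_nonneg zero_le_two] at h5
    linarith

/-- No algorithm that uses `N` coefficients beats the order `N^{-β}`, even from exact data: among
the `φ_k ⊗ φ_0` with `2rN ≤ k < 6rN` at least `N` are not observed, and a multiple of their sum is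
a bad element of the class. -/
theorem exists_le_minRadius {r : ℕ} (hr : 1 ≤ r) {s μ₁ : ℝ} (μ₂ : ℝ) (hs : 2 ≤ s) (hμ₁ : 0 < μ₁)
    (p : ℝ≥0∞) :
    ∃ c : ℝ, 0 < c ∧ ∀ δ : ℝ, 0 ≤ δ → ∀ N : ℕ, 1 ≤ N →
      ENNReal.ofReal (c * (N : ℝ) ^ (-accExp r s μ₁)) ≤ minRadius r s μ₁ μ₂ p N δ := by
  obtain ⟨c, hc, h⟩ := exists_le_norm_sum_legendreDeriv r hr
  have hr0 : (0 : ℝ) < r := by exact_mod_cast hr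
  have hs0 : 0 < s := by linarith
  refine ⟨c * ((4 * r) ^ (-(1 / s)) * (6 * r) ^ (-μ₁)), by positivity, fun δ hδ N hN => ?_⟩
  have hN0 : (0 : ℝ) < N := by exact_mod_cast hN
  refine le_iInf fun Ω => le_iInf fun _ => le_iInf fun hcard => le_iInf fun ψ => ?_
  set S : Finset ℕ := (Finset.Ico (2 * r * N) (6 * r * N)).filter fun k => (k, 0) ∉ Ω with hS
  have hSmem : ∀ k ∈ S, 2 * r * N ≤ k ∧ k < 6 * r * N ∧ (k, 0) ∉ Ω := fun k hk => by
    obtain ⟨h1, h2⟩ := Finset.mem_filter.1 hk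
    exact ⟨(Finset.mem_Ico.1 h1).1, (Finset.mem_Ico.1 h1).2, h2⟩
  have hIco : (Finset.Ico (2 * r * N) (6 * r * N)).card = 4 * r * N := by
    rw [Nat.card_Ico, ← Nat.sub_mul, ← Nat.sub_mul]
  have hrN : N ≤ r * N := Nat.le_mul_of_pos_left N hr
  have hScard : N ≤ S.card := by
    have h1 := Finset.card_filter_add_card_filter_not (s := Finset.Ico (2 * r * N) (6 * r * N))
      (fun k => (k, 0) ∉ Ω)
    have h2 : ((Finset.Ico (2 * r * N) (6 * r * N)).filter fun k => ¬ (k, 0) ∉ Ω).card ≤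
        Ω.card := by
      refine Finset.card_le_card_of_injOn (fun k => (k, 0)) (fun k hk => ?_)
        (fun k _ k' _ hkk => (Prod.ext_iff.1 hkk).1)
      exact Finset.mem_coe.2 (not_not.1 (Finset.mem_filter.1 hk).2)
    rw [hIco] at h1
    have h3 : 4 * r * N = 4 * (r * N) := by ring
    rw [← hS] at h1
    omega
  have hScard' : S.card ≤ 4 * r * N := (Finset.card_filter_le _ _).trans_eq hIco
  set A : ℝ := (4 * r * N) ^ (-(1 / s)) * (6 * r * N) ^ (-μ₁) with hA
  have hA0 : 0 < A := by positivity
  set f : L2Q := ∑ k ∈ S, A • legendreDeriv 0 (k, 0) with hf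
  have hinj : Set.InjOn (fun k : ℕ => (k, 0)) (S : Set ℕ) := fun k _ k' _ hkk =>
    (Prod.ext_iff.1 hkk).1
  set T : Finset (ℕ × ℕ) := S.image fun k => (k, 0) with hT
  have hcoeff : ∀ i : ℕ × ℕ, coeff f i = if i ∈ T then A else 0 := by
    intro i
    have h1 : coeff f i = ∑ k ∈ S, A * if (k, 0) = i then 1 else 0 := by
      rw [coeff, hf, sum_inner]
      refine Finset.sum_congr rfl fun k _ => ?_
      rw [real_inner_smul_left, ← coeff_legendreDeriv_zero]; rfl
    rw [h1, ← Finset.sum_image (f := fun i' : ℕ × ℕ => A * if i' = i then (1 : ℝ) else 0) hinj]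
    simp [hT]
  have hnorm : smoothNorm s μ₁ μ₂ f ≤ 1 := by
    rw [smoothNorm, tsum_eq_sum (s := T)]
    · rw [← ENNReal.ofReal_sum_of_nonneg fun i _ => by positivity,
        ENNReal.ofReal_rpow_of_nonneg (Finset.sum_nonneg fun i _ => by positivity) (by positivity)]
      rw [← ENNReal.ofReal_one]
      refine ENNReal.ofReal_le_ofReal (Real.rpow_le_one (Finset.sum_nonneg fun i _ => by positivity)
        ?_ (by positivity))
      rw [hT, Finset.sum_image hinj]
      calc _ ≤ ∑ _k ∈ S, (6 * r * N : ℝ) ^ (s * μ₁) * A ^ s := by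
            refine Finset.sum_le_sum fun k hk => ?_
            obtain ⟨h1, h2, -⟩ := hSmem k hk
            rw [hcoeff, if_pos (Finset.mem_image_of_mem _ hk), abs_of_pos hA0]
            simp only [Nat.cast_zero, max_eq_left zero_le_one,
              Real.one_rpow, mul_one]
            gcongr
            refine max_le ?_ ?_
            · have : 1 ≤ 6 * r * N := by nlinarith
              exact_mod_cast this
            · exact_mod_cast h2.le
        _ = S.card * ((6 * r * N : ℝ) ^ (s * μ₁) * A ^ s) := by simp
        _ ≤ (4 * r * N : ℝ) * ((6 * r * N : ℝ) ^ (s * μ₁) * A ^ s) := by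
            gcongr
            exact_mod_cast hScard'
        _ = 1 := by
            rw [hA, Real.mul_rpow (x := (4 * r * N : ℝ) ^ (-(1 / s))) (by positivity)
              (by positivity), ← Real.rpow_mul (by positivity), ← Real.rpow_mul (by positivity)]
            have h1 : -(1 / s) * s = -1 := by field_simp
            have h2 : -μ₁ * s = -(s * μ₁) := by ring
            rw [h1, h2, Real.rpow_neg (by positivity) (s * μ₁), Real.rpow_neg_one]
            have h3 : (6 * r * N : ℝ) ^ (s * μ₁) ≠ 0 := by positivity
            field_simp
    · intro i hi
      rw [hcoeff, if_neg hi, abs_zero, Real.zero_rpow hs0.ne']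
      simp
  have hTr : ∀ i ∈ T, r ≤ i.1 := by
    intro i hi
    obtain ⟨k, hk, rfl⟩ := Finset.mem_image.1 hi
    have := (hSmem k hk).1
    show r ≤ k
    nlinarith
  have hderiv : partialDeriv r f = A • ∑ k ∈ S, legendreDeriv r (k, 0) := by
    have hsummable : Summable (derivTerm r f) := by
      refine summable_of_ne_finset_zero (s := T.subtype fun i : ℕ × ℕ => r ≤ i.1) fun i hi => ?_
      rw [Finset.mem_subtype] at hi
      rw [derivTerm, hcoeff, if_neg hi, zero_smul]
    have h1 := norm_partialDeriv_sub_le hsummable T hTr (B := 0) fun U hU => by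
      refine (norm_eq_zero.2 (Finset.sum_eq_zero fun i hi => ?_)).le
      rw [hcoeff, if_neg (hU i hi).2, zero_smul]
    rw [sub_eq_zero.1 (norm_le_zero_iff.1 h1), hT, Finset.sum_image hinj, Finset.smul_sum]
    refine Finset.sum_congr rfl fun k hk => ?_
    rw [hcoeff, if_pos (Finset.mem_image_of_mem _ hk)]
  refine le_trans ?_ (enorm_partialDeriv_le_algError hδ ψ hnorm fun i hi => ?_)
  · rw [← ofReal_norm, hderiv, norm_smul, Real.norm_of_nonneg hA0.le]
    refine ENNReal.ofReal_le_ofReal ?_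
    refine le_trans (le_of_eq ?_) (mul_le_mul_of_nonneg_left (h N S hN (fun k hk => (hSmem k hk).1)
      (fun k hk => (hSmem k hk).2.1) hScard) hA0.le)
    rw [hA, Real.mul_rpow (by positivity) hN0.le, Real.mul_rpow (by positivity) hN0.le]
    have h1 : (N : ℝ) ^ (-accExp r s μ₁) =
        (N : ℝ) ^ (-(1 / s)) * (N : ℝ) ^ (-μ₁) * (N : ℝ) ^ (2 * (r : ℝ) + 1 / 2) := by
      rw [← Real.rpow_add hN0, ← Real.rpow_add hN0, accExp]
      congr 1; ring
    rw [h1]; ring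
  · rw [hcoeff, if_neg]
    intro hiT
    obtain ⟨k, hk, rfl⟩ := Finset.mem_image.1 hiT
    exact (hSmem k hk).2.2 hi

theorem minRadius_le_truncError {r : ℕ} (hr : 1 ≤ r) {s μ₁ μ₂ : ℝ} {p : ℝ≥0∞} {δ γ : ℝ}
    (hγ : 1 ≤ γ) {n N : ℕ} (h : (hyperbolicCross r n γ).card ≤ N) :
    minRadius r s μ₁ μ₂ p N δ ≤ truncError r s μ₁ μ₂ p δ n γ :=
  iInf_le_of_le (hyperbolicCross r n γ) (iInf_le_of_le
    (fun i hi => ((mem_hyperbolicCross hr hγ i).1 hi).1) (iInf_le_of_le h (iInf_le _ _)))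

/-! ### The choice of the truncation level -/

theorem rpow_neg_mul_rpow_neg_le {β b x y : ℝ} (hβ : 0 < β) (hb : 0 < b) (hx : 0 < x) (hy : 0 < y)
    (h : y ≤ b * x) : b ^ (-β) * x ^ (-β) ≤ y ^ (-β) := by
  rw [← Real.mul_rpow hb.le hx.le]
  exact Real.rpow_le_rpow_of_nonpos hy h (by linarith)

theorem rpow_neg_le_mul_rpow_neg {β b x y : ℝ} (hβ : 0 < β) (hb : 0 < b) (hx : 0 < x) (hy : 0 < y)
    (h : y ≤ b * x) : x ^ (-β) ≤ b ^ β * y ^ (-β) := by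
  have h1 := rpow_neg_mul_rpow_neg_le hβ hb hx hy h
  rw [Real.rpow_neg hb.le, inv_mul_le_iff₀ (by positivity)] at h1
  exact h1

theorem rpow_div_eq_rpow_neg {δ β ν : ℝ} (hδ : 0 < δ) :
    δ ^ (β / ν) = (δ ^ (-(1 / ν))) ^ (-β) := by
  rw [← Real.rpow_mul hδ.le]
  congr 1; ring

theorem log_one_div_eq {δ ν : ℝ} (hδ : 0 < δ) (hν : 0 < ν) :
    Real.log (1 / δ) = ν * Real.log (δ ^ (-(1 / ν))) := by
  rw [Real.log_rpow hδ, one_div, Real.log_inv]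
  field_simp

theorem one_lt_rpow_neg_one_div {δ ν : ℝ} (hδ : 0 < δ) (hδ1 : δ < 1) (hν : 0 < ν) :
    1 < δ ^ (-(1 / ν)) :=
  Real.one_lt_rpow_of_pos_of_lt_one_of_neg hδ hδ1 (by simpa using hν)

theorem le_rpow_neg_one_div {δ ν x : ℝ} (hδ : 0 < δ) (hν : 0 < ν) (hx : 0 < x)
    (h : δ ≤ x ^ (-ν)) : x ≤ δ ^ (-(1 / ν)) := by
  have h1 := Real.rpow_le_rpow_of_nonpos hδ h (show -(1 / ν) ≤ 0 by simpa using hν.le)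
  rw [← Real.rpow_mul hx.le] at h1
  have h2 : -ν * -(1 / ν) = 1 := by field_simp
  rwa [h2, Real.rpow_one] at h1

theorem accExp_lt_noiseExp {r : ℕ} (hr : 1 ≤ r) (s μ₁ : ℝ) {p : ℝ≥0∞} (hp : 1 ≤ p) :
    accExp r s μ₁ < noiseExp s μ₁ p := by
  have hr' : (1 : ℝ) ≤ r := by exact_mod_cast hr
  have hp1 : (p⁻¹).toReal ≤ 1 := by
    rw [← ENNReal.toReal_one]
    exact ENNReal.toReal_mono ENNReal.one_ne_top (ENNReal.inv_le_one.2 hp)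
  rw [accExp, noiseExp]
  linarith

/-- At the level `n ≍ δ^{-1/ν}` the truncation error and the amplified noise are balanced. -/
theorem exists_truncError_le_rpow {r : ℕ} (hr : 1 ≤ r) {s μ₁ μ₂ γ : ℝ} (hs : 2 ≤ s)
    (hβ : 0 < accExp r s μ₁) (hμ : accExp r s μ₁ < μ₂ + 1 / s - 1 / 2) (hγ : 1 ≤ γ)
    (hγβ : γ * accExp r s μ₁ < μ₂ + 1 / s - 1 / 2) {p : ℝ≥0∞} (hp : 1 ≤ p) {κ b : ℝ}
    (hκ : 0 < κ) (hb : 0 < b) :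
    ∃ C : ℝ, 0 < C ∧ ∀ δ : ℝ, 0 < δ → δ < 1 → ∀ n : ℕ,
      κ * δ ^ (-(1 / noiseExp s μ₁ p)) ≤ (n : ℝ) + 1 → n ≤ b * δ ^ (-(1 / noiseExp s μ₁ p)) →
      truncError r s μ₁ μ₂ p δ n γ ≤
        ENNReal.ofReal (C * δ ^ (accExp r s μ₁ / noiseExp s μ₁ p)) := by
  obtain ⟨C, hC, h⟩ := exists_truncError_le hr hs hβ hμ hγ hγβ hp
  have hβν := accExp_lt_noiseExp hr s μ₁ hp
  set β := accExp r s μ₁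
  set ν := noiseExp s μ₁ p
  refine ⟨C * (κ ^ (-β) + b ^ (ν - β)), by positivity, fun δ hδ hδ1 n h1 h2 => ?_⟩
  refine (h δ hδ n).trans (ENNReal.ofReal_le_ofReal ?_)
  have hν : 0 < ν := by linarith
  rw [rpow_div_eq_rpow_neg hδ]
  have hX := one_lt_rpow_neg_one_div hδ hδ1 hν
  have hδX : δ = (δ ^ (-(1 / ν))) ^ (-ν) := by
    rw [← Real.rpow_mul hδ.le]
    have : -(1 / ν) * -ν = 1 := by field_simp
    rw [this, Real.rpow_one]
  set X := δ ^ (-(1 / ν))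
  have hX0 : 0 < X := by linarith
  have h3 : ((n : ℝ) + 1) ^ (-β) ≤ κ ^ (-β) * X ^ (-β) := by
    rw [← Real.mul_rpow hκ.le hX0.le]
    exact Real.rpow_le_rpow_of_nonpos (by positivity) h1 (by linarith)
  have h4 : δ * (n : ℝ) ^ (ν - β) ≤ b ^ (ν - β) * X ^ (-β) := by
    calc δ * (n : ℝ) ^ (ν - β) ≤ X ^ (-ν) * (b * X) ^ (ν - β) := by
          rw [← hδX]
          gcongr
      _ = b ^ (ν - β) * (X ^ (-ν) * X ^ (ν - β)) := by
          rw [Real.mul_rpow hb.le hX0.le]; ring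
      _ = _ := by
          rw [← Real.rpow_add hX0]
          congr 2; ring
  rw [mul_assoc]
  refine mul_le_mul_of_nonneg_left ?_ hC.le
  linarith

theorem floor_mul_bounds {κ X : ℝ} (hκ : 0 < κ) (hX : 0 < X) :
    κ * X ≤ (⌊κ * X⌋₊ : ℝ) + 1 ∧ (⌊κ * X⌋₊ : ℝ) ≤ κ * X :=
  ⟨(Nat.lt_floor_add_one _).le, Nat.floor_le (by positivity)⟩

/-- In the regime `κ X ≥ 1` rounding down loses a factor `2` at most. -/
theorem half_mul_le_floor {κ X : ℝ} (h : 1 ≤ κ * X) : κ / 2 * X ≤ (⌊κ * X⌋₊ : ℝ) := by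
  have h1 := Nat.lt_floor_add_one (κ * X)
  have h2 : (1 : ℝ) ≤ (⌊κ * X⌋₊ : ℝ) := by exact_mod_cast (Nat.one_le_floor_iff _).2 h
  linarith

/-- For `γ > 1` the level `n = ⌊κ δ^{-1/ν}⌋` with a small `κ` respects the budget `N`. -/
theorem exists_card_hyperbolicCross_floor_le {r : ℕ} (hr : 1 ≤ r) {γ : ℝ} (hγ : 1 < γ) {c : ℝ}
    (hc : 0 < c) : ∃ κ : ℝ, 0 < κ ∧ ∀ X : ℝ, 0 < X → ∀ N : ℕ, c * X ≤ N →
      (hyperbolicCross r ⌊κ * X⌋₊ γ).card ≤ N := by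
  obtain ⟨C, hC, h⟩ := exists_card_hyperbolicCross_le hr hγ
  refine ⟨c / C, by positivity, fun X hX N hN => ?_⟩
  have h1 := h ⌊c / C * X⌋₊
  have h2 := (floor_mul_bounds (show 0 < c / C by positivity) hX).2
  have h3 : C * (⌊c / C * X⌋₊ : ℝ) ≤ c * X := by
    calc C * (⌊c / C * X⌋₊ : ℝ) ≤ C * (c / C * X) := by gcongr
      _ = c * X := by field_simp
  exact_mod_cast h1.trans (h3.trans hN)

theorem card_hyperbolicCross_zero {r : ℕ} (hr : 1 ≤ r) (γ : ℝ) :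
    (hyperbolicCross r 0 γ).card = 0 := by
  rw [hyperbolicCross, Finset.Icc_eq_empty (by omega)]
  simp

/-- For `γ = 1` the budget has to contain an additional logarithm. -/
theorem card_hyperbolicCross_one_floor_le {r : ℕ} (hr : 1 ≤ r) {c κ X : ℝ} (hκ : 0 < κ)
    (hκ1 : κ ≤ 1) (hκc : 3 * κ ≤ c) (hX : Real.exp 1 ≤ X) {N : ℕ} (hN : c * (X * Real.log X) ≤ N) :
    (hyperbolicCross r ⌊κ * X⌋₊ 1).card ≤ N := by
  have hX0 : 0 < X := (Real.exp_pos 1).trans_le hX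
  have hlog : 1 ≤ Real.log X := by
    rw [← Real.log_exp 1]; exact Real.log_le_log (Real.exp_pos 1) hX
  have h1 := card_hyperbolicCross_one_le hr ⌊κ * X⌋₊
  have h2 := (floor_mul_bounds hκ hX0).2
  rcases Nat.eq_zero_or_pos ⌊κ * X⌋₊ with h0 | h0
  · rw [h0, card_hyperbolicCross_zero hr]; exact Nat.zero_le _
  have h3 : Real.log (⌊κ * X⌋₊ : ℝ) ≤ Real.log X :=
    Real.log_le_log (by exact_mod_cast h0) (h2.trans (mul_le_of_le_one_left hX0.le hκ1))
  have h4 : (⌊κ * X⌋₊ : ℝ) * (2 + Real.log ⌊κ * X⌋₊) ≤ N := by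
    calc (⌊κ * X⌋₊ : ℝ) * (2 + Real.log ⌊κ * X⌋₊) ≤ (κ * X) * (3 * Real.log X) := by
          have : 2 + Real.log (⌊κ * X⌋₊ : ℝ) ≤ 3 * Real.log X := by linarith
          exact mul_le_mul h2 this (by
            have : 0 ≤ Real.log (⌊κ * X⌋₊ : ℝ) := Real.log_natCast_nonneg _
            linarith) (by positivity)
      _ = 3 * κ * (X * Real.log X) := by ring
      _ ≤ c * (X * Real.log X) := by gcongr
      _ ≤ N := hN
  exact_mod_cast h1.trans h4

/-- If `N ≍ X log X`, then `N / log N` is at most of the order `X`. -/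
theorem exists_div_log_le {c₁ c₂ : ℝ} (hc₁ : 0 < c₁) (hc₂ : 0 < c₂) :
    ∃ C : ℝ, 0 < C ∧ ∀ X : ℝ, 1 < X → ∀ N : ℕ, 2 ≤ N → c₁ * (X * Real.log X) ≤ N →
      N ≤ c₂ * (X * Real.log X) → (N : ℝ) / Real.log N ≤ C * X := by
  have hl2 : 0 < Real.log 2 := Real.log_pos (by norm_num)
  set D : ℝ := 1 + (1 + |Real.log c₁|) / Real.log 2 with hD
  have hD0 : 0 < D := by positivity
  refine ⟨c₂ * D, by positivity, fun X hX N hN h1 h2 => ?_⟩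
  have hX0 : 0 < X := by linarith
  have hN2 : (2 : ℝ) ≤ N := by exact_mod_cast hN
  have hlN : Real.log 2 ≤ Real.log N := Real.log_le_log (by norm_num) hN2
  have hlN0 : 0 < Real.log N := by linarith
  have hkey : Real.log X ≤ D * Real.log N := by
    have h3 : (1 + |Real.log c₁|) ≤ (1 + |Real.log c₁|) / Real.log 2 * Real.log N := by
      rw [div_mul_eq_mul_div, le_div_iff₀ hl2]
      gcongr
    have h4 : Real.log X ≤ Real.log N + (1 + |Real.log c₁|) := by
      rcases lt_or_ge X (Real.exp 1) with h | h
      · have := Real.log_lt_log hX0 h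
        rw [Real.log_exp] at this
        linarith [abs_nonneg (Real.log c₁)]
      · have hlog : 1 ≤ Real.log X := by
          rw [← Real.log_exp 1]; exact Real.log_le_log (Real.exp_pos 1) h
        have h5 : c₁ * X ≤ N := by
          refine le_trans ?_ h1
          gcongr
          exact le_mul_of_one_le_right hX0.le hlog
        have h6 := Real.log_le_log (by positivity) h5
        rw [Real.log_mul hc₁.ne' hX0.ne'] at h6
        linarith [neg_abs_le (Real.log c₁)]
    rw [hD, add_mul, one_mul]
    linarith
  rw [div_le_iff₀ hlN0]
  calc (N : ℝ) ≤ c₂ * (X * Real.log X) := h2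
    _ ≤ c₂ * (X * (D * Real.log N)) := by gcongr
    _ = _ := by ring

end NumDiff

theorem mainTheorem2 (r : ℕ) (hr : 1 ≤ r) (s μ₁ μ₂ : ℝ) (p : ℝ≥0∞) (hs : 2 ≤ s)
    (hμ₁ : 2 * (r : ℝ) - 1 / s + 1 / 2 < μ₁) (hμ₂ : μ₁ - 2 * (r : ℝ) < μ₂) (hp : 1 ≤ p) :
    -- the series that defines the derivative converges (unconditionally) in L₂ on the whole space
    (∀ f : NumDiff.L2Q, NumDiff.smoothNorm s μ₁ μ₂ f < ⊤ → Summable (NumDiff.derivTerm r f)) ∧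
    -- (a) the order of the minimal radius
    (∀ c₁ c₂ : ℝ, 0 < c₁ → 0 < c₂ → ∃ C₁ C₂ : ℝ, 0 < C₁ ∧ 0 < C₂ ∧
      ∀ δ : ℝ, 0 < δ → δ < 1 → ∀ N : ℕ,
        NumDiff.Between c₁ c₂ (δ ^ (-(1 / NumDiff.noiseExp s μ₁ p))) N →
        NumDiff.EBetween C₁ C₂ ((N : ℝ) ^ (-NumDiff.accExp r s μ₁))
          (NumDiff.minRadius r s μ₁ μ₂ p N δ) ∧
        NumDiff.EBetween C₁ C₂ (δ ^ (NumDiff.accExp r s μ₁ / NumDiff.noiseExp s μ₁ p))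
          (NumDiff.minRadius r s μ₁ μ₂ p N δ)) ∧
    -- (a) the truncation method has this order of accuracy, and attains it within the budget N
    (∀ γ : ℝ, 1 < γ → γ < (μ₂ + 1 / s - 1 / 2) / NumDiff.accExp r s μ₁ →
      ∀ c₁ c₂ : ℝ, 0 < c₁ → 0 < c₂ →
      (∃ C₁ C₂ : ℝ, 0 < C₁ ∧ 0 < C₂ ∧
        ∀ δ : ℝ, 0 < δ → δ < 1 → ∀ n : ℕ,
          NumDiff.Between c₁ c₂ (δ ^ (-(1 / NumDiff.noiseExp s μ₁ p))) n →
          NumDiff.EBetween C₁ C₂ (δ ^ (NumDiff.accExp r s μ₁ / NumDiff.noiseExp s μ₁ p))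
            (NumDiff.truncError r s μ₁ μ₂ p δ n γ)) ∧
      (∃ a₁ a₂ C δ₀ : ℝ, 0 < a₁ ∧ 0 < a₂ ∧ 0 < C ∧ 0 < δ₀ ∧
        ∀ δ : ℝ, 0 < δ → δ < 1 → δ < δ₀ → ∀ N : ℕ,
          NumDiff.Between c₁ c₂ (δ ^ (-(1 / NumDiff.noiseExp s μ₁ p))) N →
          ∃ n : ℕ, NumDiff.Between a₁ a₂ (δ ^ (-(1 / NumDiff.noiseExp s μ₁ p))) n ∧
            (NumDiff.hyperbolicCross r n γ).card ≤ N ∧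
            NumDiff.truncError r s μ₁ μ₂ p δ n γ ≤
              ENNReal.ofReal (C * (N : ℝ) ^ (-NumDiff.accExp r s μ₁)) ∧
            NumDiff.truncError r s μ₁ μ₂ p δ n γ ≤ ENNReal.ofReal
              (C * δ ^ (NumDiff.accExp r s μ₁ / NumDiff.noiseExp s μ₁ p)))) ∧
    -- (b) the bounds for the minimal radius up to a logarithmic factor
    (∀ c₁ c₂ : ℝ, 0 < c₁ → 0 < c₂ → ∃ C₁ C₂ : ℝ, 0 < C₁ ∧ 0 < C₂ ∧
      ∀ δ : ℝ, 0 < δ → δ < 1 → ∀ N : ℕ, 2 ≤ N →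
        NumDiff.Between c₁ c₂
          (δ ^ (-(1 / NumDiff.noiseExp s μ₁ p)) * Real.log (1 / δ)) N →
        (ENNReal.ofReal (C₁ * (N : ℝ) ^ (-NumDiff.accExp r s μ₁)) ≤
            NumDiff.minRadius r s μ₁ μ₂ p N δ ∧
          NumDiff.minRadius r s μ₁ μ₂ p N δ ≤
            ENNReal.ofReal (C₂ * ((N : ℝ) / Real.log N) ^ (-NumDiff.accExp r s μ₁))) ∧
        (ENNReal.ofReal (C₁ * (δ ^ (NumDiff.accExp r s μ₁ / NumDiff.noiseExp s μ₁ p) *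
              Real.log (1 / δ) ^ (-NumDiff.accExp r s μ₁))) ≤
            NumDiff.minRadius r s μ₁ μ₂ p N δ ∧
          NumDiff.minRadius r s μ₁ μ₂ p N δ ≤
            ENNReal.ofReal (C₂ * δ ^ (NumDiff.accExp r s μ₁ / NumDiff.noiseExp s μ₁ p)))) ∧
    -- (b) the truncation method with γ = 1 attains the upper bounds
    (∀ c₁ c₂ : ℝ, 0 < c₁ → 0 < c₂ →
      (∃ C : ℝ, 0 < C ∧
        ∀ δ : ℝ, 0 < δ → δ < 1 → ∀ n : ℕ,
          NumDiff.Between c₁ c₂ (δ ^ (-(1 / NumDiff.noiseExp s μ₁ p))) n →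
          NumDiff.truncError r s μ₁ μ₂ p δ n 1 ≤ ENNReal.ofReal
            (C * δ ^ (NumDiff.accExp r s μ₁ / NumDiff.noiseExp s μ₁ p))) ∧
      (∃ a₁ a₂ C δ₀ : ℝ, 0 < a₁ ∧ 0 < a₂ ∧ 0 < C ∧ 0 < δ₀ ∧
        ∀ δ : ℝ, 0 < δ → δ < 1 → δ < δ₀ → ∀ N : ℕ,
          NumDiff.Between c₁ c₂
            (δ ^ (-(1 / NumDiff.noiseExp s μ₁ p)) * Real.log (1 / δ)) N →
          ∃ n : ℕ, NumDiff.Between a₁ a₂ (δ ^ (-(1 / NumDiff.noiseExp s μ₁ p))) n ∧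
            (NumDiff.hyperbolicCross r n 1).card ≤ N ∧
            NumDiff.truncError r s μ₁ μ₂ p δ n 1 ≤ ENNReal.ofReal
              (C * ((N : ℝ) / Real.log N) ^ (-NumDiff.accExp r s μ₁)) ∧
            NumDiff.truncError r s μ₁ μ₂ p δ n 1 ≤ ENNReal.ofReal
              (C * δ ^ (NumDiff.accExp r s μ₁ / NumDiff.noiseExp s μ₁ p)))) := by
  have hr' : (1 : ℝ) ≤ r := by exact_mod_cast hr
  have hs0 : 0 < s := by linarith
  have hβ : 0 < NumDiff.accExp r s μ₁ := by rw [NumDiff.accExp]; linarith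
  have hβν := NumDiff.accExp_lt_noiseExp hr s μ₁ hp
  have hμ : NumDiff.accExp r s μ₁ < μ₂ + 1 / s - 1 / 2 := by rw [NumDiff.accExp]; linarith
  have h1s : 1 / s ≤ 1 / 2 := one_div_le_one_div_of_le (by norm_num) hs
  obtain ⟨c₀, hc₀, hlow⟩ := NumDiff.exists_le_minRadius hr μ₂ hs (by linarith : 0 < μ₁) p
  set β := NumDiff.accExp r s μ₁ with hβdef
  set ν := NumDiff.noiseExp s μ₁ p with hνdef
  have hν : 0 < ν := by linarith
  refine ⟨fun f hf => NumDiff.summable_derivTerm hr hs hβ hμ hf, ?_, ?_, ?_, ?_⟩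
  · intro c₁ c₂ hc₁ hc₂
    obtain ⟨γ, hγ1, hγ2⟩ := exists_between ((one_lt_div hβ).2 hμ)
    rw [lt_div_iff₀ hβ] at hγ2
    obtain ⟨κ, hκ, hcard⟩ := NumDiff.exists_card_hyperbolicCross_floor_le hr hγ1 hc₁
    obtain ⟨C, hC, hup⟩ := NumDiff.exists_truncError_le_rpow hr hs hβ hμ hγ1.le hγ2 hp hκ hκ
    refine ⟨min c₀ (c₀ * c₂ ^ (-β)), max C (C * c₂ ^ β), by positivity, by positivity,
      fun δ hδ hδ1 N hN => ?_⟩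
    obtain ⟨hN1, hN2⟩ := hN
    have hX := NumDiff.one_lt_rpow_neg_one_div hδ hδ1 hν
    have hup' := hup δ hδ hδ1
    rw [NumDiff.rpow_div_eq_rpow_neg hδ] at hup' ⊢
    set X := δ ^ (-(1 / ν))
    have hX0 : 0 < X := by linarith
    have hN0 : (0 : ℝ) < N := lt_of_lt_of_le (by positivity) hN1
    have hlowN := hlow δ hδ.le N (by exact_mod_cast hN0)
    have hfl := NumDiff.floor_mul_bounds hκ hX0
    have hupN := (NumDiff.minRadius_le_truncError hr hγ1.le (hcard X hX0 N hN1)).trans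
      (hup' ⌊κ * X⌋₊ hfl.1 hfl.2)
    have hcmp1 := NumDiff.rpow_neg_mul_rpow_neg_le hβ hc₂ hX0 hN0 hN2
    have hcmp2 := NumDiff.rpow_neg_le_mul_rpow_neg hβ hc₂ hX0 hN0 hN2
    refine ⟨⟨le_trans (ENNReal.ofReal_le_ofReal ?_) hlowN,
      hupN.trans (ENNReal.ofReal_le_ofReal ?_)⟩,
      ⟨le_trans (ENNReal.ofReal_le_ofReal ?_) hlowN,
        hupN.trans (ENNReal.ofReal_le_ofReal ?_)⟩⟩
    · gcongr; exact min_le_left _ _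
    · calc C * X ^ (-β) ≤ C * (c₂ ^ β * (N : ℝ) ^ (-β)) := by gcongr
        _ = (C * c₂ ^ β) * (N : ℝ) ^ (-β) := by ring
        _ ≤ _ := by gcongr; exact le_max_right _ _
    · calc _ ≤ (c₀ * c₂ ^ (-β)) * X ^ (-β) := by gcongr; exact min_le_right _ _
        _ = c₀ * (c₂ ^ (-β) * X ^ (-β)) := by ring
        _ ≤ _ := by gcongr
    · gcongr; exact le_max_left _ _
  · intro γ hγ1 hγ2 c₁ c₂ hc₁ hc₂
    rw [lt_div_iff₀ hβ] at hγ2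
    constructor
    · obtain ⟨C, hC, hup⟩ := NumDiff.exists_truncError_le_rpow hr hs hβ hμ hγ1.le hγ2 hp hc₁ hc₂
      obtain ⟨D, hD, hcard⟩ := NumDiff.exists_card_hyperbolicCross_le hr hγ1
      refine ⟨c₀ * ((D + 1) * c₂) ^ (-β), C, by positivity, hC, fun δ hδ hδ1 n hn => ?_⟩
      obtain ⟨hn1, hn2⟩ := hn
      refine ⟨?_, hup δ hδ hδ1 n (by linarith) hn2⟩
      have hX := NumDiff.one_lt_rpow_neg_one_div hδ hδ1 hν
      rw [NumDiff.rpow_div_eq_rpow_neg hδ]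
      set X := δ ^ (-(1 / ν))
      have hX0 : 0 < X := by linarith
      have hn0 : (0 : ℝ) < n := lt_of_lt_of_le (by positivity) hn1
      have hn1' : (1 : ℝ) ≤ n := by exact_mod_cast (by exact_mod_cast hn0 : 0 < n)
      have hDn : 0 < D * n := by positivity
      have hN0 : 0 < ⌈D * (n : ℝ)⌉₊ := Nat.ceil_pos.2 hDn
      have hNle : (⌈D * (n : ℝ)⌉₊ : ℝ) ≤ (D + 1) * c₂ * X := by
        calc (⌈D * (n : ℝ)⌉₊ : ℝ) ≤ D * n + 1 := (Nat.ceil_lt_add_one hDn.le).le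
          _ ≤ (D + 1) * n := by linarith
          _ ≤ (D + 1) * (c₂ * X) := by gcongr
          _ = _ := by ring
      have hcmp := NumDiff.rpow_neg_mul_rpow_neg_le hβ (by positivity) hX0
        (by exact_mod_cast hN0) hNle
      refine le_trans (ENNReal.ofReal_le_ofReal ?_) ((hlow δ hδ.le _ hN0).trans
        (NumDiff.minRadius_le_truncError hr hγ1.le (n := n) ?_))
      · rw [mul_assoc]; gcongr
      · exact_mod_cast (hcard n).trans (Nat.le_ceil _)
    · obtain ⟨κ, hκ, hcard⟩ := NumDiff.exists_card_hyperbolicCross_floor_le hr hγ1 hc₁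
      obtain ⟨C, hC, hup⟩ := NumDiff.exists_truncError_le_rpow hr hs hβ hμ hγ1.le hγ2 hp hκ hκ
      refine ⟨κ / 2, κ, max C (C * c₂ ^ β), (1 / κ) ^ (-ν), by positivity, hκ, by positivity,
        by positivity, fun δ hδ hδ1 hδ0 N hN => ?_⟩
      obtain ⟨hN1, hN2⟩ := hN
      have hX := NumDiff.one_lt_rpow_neg_one_div hδ hδ1 hν
      have hXκ := NumDiff.le_rpow_neg_one_div hδ hν (by positivity) hδ0.le
      have hup' := hup δ hδ hδ1
      rw [NumDiff.rpow_div_eq_rpow_neg hδ] at hup' ⊢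
      set X := δ ^ (-(1 / ν))
      have hX0 : 0 < X := by linarith
      have hN0 : (0 : ℝ) < N := lt_of_lt_of_le (by positivity) hN1
      rw [div_le_iff₀ hκ] at hXκ
      have hfl := NumDiff.floor_mul_bounds hκ hX0
      have hupN := hup' ⌊κ * X⌋₊ hfl.1 hfl.2
      have hcmp2 := NumDiff.rpow_neg_le_mul_rpow_neg hβ hc₂ hX0 hN0 hN2
      refine ⟨⌊κ * X⌋₊, ⟨NumDiff.half_mul_le_floor (by linarith), hfl.2⟩, hcard X hX0 N hN1,
        hupN.trans (ENNReal.ofReal_le_ofReal ?_), hupN.trans (ENNReal.ofReal_le_ofReal ?_)⟩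
      · calc C * X ^ (-β) ≤ C * (c₂ ^ β * (N : ℝ) ^ (-β)) := by gcongr
          _ = (C * c₂ ^ β) * (N : ℝ) ^ (-β) := by ring
          _ ≤ _ := by gcongr; exact le_max_right _ _
      · gcongr; exact le_max_left _ _
  · intro c₁ c₂ hc₁ hc₂
    obtain ⟨D, hD, hdiv⟩ := NumDiff.exists_div_log_le (mul_pos hc₁ hν) (mul_pos hc₂ hν)
    set κ : ℝ := min 1 (c₁ * ν / 3) with hκdef
    have hκ : 0 < κ := by positivity
    set κ' : ℝ := min κ (Real.exp 1)⁻¹ with hκ'def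
    have hκ' : 0 < κ' := lt_min hκ (by positivity)
    obtain ⟨C, hC, hup⟩ := NumDiff.exists_truncError_le_rpow hr hs hβ hμ le_rfl
      (by rwa [one_mul]) hp hκ' one_pos
    refine ⟨min c₀ (c₀ * c₂ ^ (-β)), max C (C * D ^ β), by positivity, by positivity,
      fun δ hδ hδ1 N hN2 hN => ?_⟩
    obtain ⟨hNl, hNu⟩ := hN
    have hX := NumDiff.one_lt_rpow_neg_one_div hδ hδ1 hν
    have hup' := hup δ hδ hδ1
    have hlog := NumDiff.log_one_div_eq hδ hν
    have hL : 0 < Real.log (1 / δ) := Real.log_pos (by rw [one_lt_div hδ]; exact hδ1)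
    rw [NumDiff.rpow_div_eq_rpow_neg hδ] at hup' ⊢
    set X := δ ^ (-(1 / ν))
    have hX0 : 0 < X := by linarith
    have hN0 : (0 : ℝ) < N := by exact_mod_cast (by omega : 0 < N)
    have hlowN := hlow δ hδ.le N (by omega)
    have hNl' : c₁ * ν * (X * Real.log X) ≤ N := by
      refine le_trans (le_of_eq ?_) hNl
      rw [hlog]; ring
    have hNu' : (N : ℝ) ≤ c₂ * ν * (X * Real.log X) := by
      refine hNu.trans (le_of_eq ?_)
      rw [hlog]; ring
    have hNlog := hdiv X hX N hN2 hNl' hNu'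
    have hlogN : 0 < Real.log N := Real.log_pos (by exact_mod_cast (by omega : 1 < N))
    have hupN : NumDiff.minRadius r s μ₁ μ₂ p N δ ≤ ENNReal.ofReal (C * X ^ (-β)) := by
      rcases lt_or_ge X (Real.exp 1) with hXe | hXe
      · -- for bounded `X` no information is needed
        refine (NumDiff.minRadius_le_truncError hr le_rfl (n := 0) ?_).trans (hup' 0 ?_ ?_)
        · rw [NumDiff.card_hyperbolicCross_zero hr]; exact Nat.zero_le _
        · calc κ' * X ≤ (Real.exp 1)⁻¹ * Real.exp 1 := by
                gcongr; exact min_le_right _ _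
            _ = ((0 : ℕ) : ℝ) + 1 := by
                rw [inv_mul_cancel₀ (Real.exp_pos 1).ne']; simp
        · rw [Nat.cast_zero]; positivity
      · have hfl := NumDiff.floor_mul_bounds hκ hX0
        refine (NumDiff.minRadius_le_truncError hr le_rfl (NumDiff.card_hyperbolicCross_one_floor_le
          hr hκ (min_le_left _ _) ?_ hXe hNl')).trans (hup' ⌊κ * X⌋₊ ?_ ?_)
        · linarith [min_le_right 1 (c₁ * ν / 3)]
        · refine le_trans ?_ hfl.1
          gcongr; exact min_le_left _ _
        · refine hfl.2.trans ?_
          gcongr; exact min_le_left _ _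
    have hcmp1 := NumDiff.rpow_neg_mul_rpow_neg_le hβ hc₂ (mul_pos hX0 hL) hN0 hNu
    have hcmp2 := NumDiff.rpow_neg_le_mul_rpow_neg hβ hD hX0 (div_pos hN0 hlogN) hNlog
    refine ⟨⟨le_trans (ENNReal.ofReal_le_ofReal ?_) hlowN,
      hupN.trans (ENNReal.ofReal_le_ofReal ?_)⟩,
      ⟨le_trans (ENNReal.ofReal_le_ofReal ?_) hlowN,
        hupN.trans (ENNReal.ofReal_le_ofReal ?_)⟩⟩
    · gcongr; exact min_le_left _ _
    · calc C * X ^ (-β) ≤ C * (D ^ β * ((N : ℝ) / Real.log N) ^ (-β)) := by gcongr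
        _ = (C * D ^ β) * ((N : ℝ) / Real.log N) ^ (-β) := by ring
        _ ≤ _ := by gcongr; exact le_max_right _ _
    · rw [Real.mul_rpow hX0.le hL.le] at hcmp1
      calc _ ≤ (c₀ * c₂ ^ (-β)) * (X ^ (-β) * Real.log (1 / δ) ^ (-β)) := by
            gcongr; exact min_le_right _ _
        _ = c₀ * (c₂ ^ (-β) * (X ^ (-β) * Real.log (1 / δ) ^ (-β))) := by ring
        _ ≤ _ := by gcongr
    · gcongr; exact le_max_left _ _
  · intro c₁ c₂ hc₁ hc₂
    constructor
    · obtain ⟨C, hC, hup⟩ := NumDiff.exists_truncError_le_rpow hr hs hβ hμ le_rfl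
        (by rwa [one_mul]) hp hc₁ hc₂
      exact ⟨C, hC, fun δ hδ hδ1 n hn => hup δ hδ hδ1 n (by linarith [hn.1]) hn.2⟩
    · obtain ⟨D, hD, hdiv⟩ := NumDiff.exists_div_log_le (mul_pos hc₁ hν) (mul_pos hc₂ hν)
      set κ : ℝ := min 1 (c₁ * ν / 3) with hκdef
      have hκ : 0 < κ := by positivity
      have hκ3 : 3 * κ ≤ c₁ * ν := by linarith [min_le_right 1 (c₁ * ν / 3)]
      obtain ⟨C, hC, hup⟩ := NumDiff.exists_truncError_le_rpow hr hs hβ hμ le_rfl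
        (by rwa [one_mul]) hp hκ hκ
      refine ⟨κ / 2, κ, max C (C * D ^ β), min ((1 / κ) ^ (-ν)) (Real.exp 1 ^ (-ν)), by positivity,
        hκ, by positivity, by positivity, fun δ hδ hδ1 hδ0 N hN => ?_⟩
      obtain ⟨hNl, hNu⟩ := hN
      have hX := NumDiff.one_lt_rpow_neg_one_div hδ hδ1 hν
      have hXκ := NumDiff.le_rpow_neg_one_div hδ hν (by positivity)
        (hδ0.le.trans (min_le_left _ _))
      have hXe := NumDiff.le_rpow_neg_one_div hδ hν (Real.exp_pos 1)
        (hδ0.le.trans (min_le_right _ _))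
      have hup' := hup δ hδ hδ1
      have hlog := NumDiff.log_one_div_eq hδ hν
      rw [NumDiff.rpow_div_eq_rpow_neg hδ] at hup' ⊢
      set X := δ ^ (-(1 / ν))
      have hX0 : 0 < X := by linarith
      rw [div_le_iff₀ hκ] at hXκ
      have hNl' : c₁ * ν * (X * Real.log X) ≤ N := by
        refine le_trans (le_of_eq ?_) hNl
        rw [hlog]; ring
      have hNu' : (N : ℝ) ≤ c₂ * ν * (X * Real.log X) := by
        refine hNu.trans (le_of_eq ?_)
        rw [hlog]; ring
      -- `δ` is so small that `N ≥ 2`, hence `log N > 0`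
      have hN2 : 2 ≤ N := by
        have hlogX : 1 ≤ Real.log X := by
          rw [← Real.log_exp 1]; exact Real.log_le_log (Real.exp_pos 1) hXe
        have h1 : 3 * κ * (X * 1) ≤ c₁ * ν * (X * Real.log X) := by gcongr
        have h2 : (2 : ℝ) ≤ N := by linarith
        exact_mod_cast h2
      have hN0 : (0 : ℝ) < N := by exact_mod_cast (by omega : 0 < N)
      have hNlog := hdiv X hX N hN2 hNl' hNu'
      have hlogN : 0 < Real.log N := Real.log_pos (by exact_mod_cast (by omega : 1 < N))
      have hcmp2 := NumDiff.rpow_neg_le_mul_rpow_neg hβ hD hX0 (div_pos hN0 hlogN) hNlog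
      have hfl := NumDiff.floor_mul_bounds hκ hX0
      have hupN := hup' ⌊κ * X⌋₊ hfl.1 hfl.2
      refine ⟨⌊κ * X⌋₊, ⟨NumDiff.half_mul_le_floor (by linarith), hfl.2⟩,
        NumDiff.card_hyperbolicCross_one_floor_le hr hκ (min_le_left _ _) hκ3 hXe hNl',
        hupN.trans (ENNReal.ofReal_le_ofReal ?_), hupN.trans (ENNReal.ofReal_le_ofReal ?_)⟩
      · calc C * X ^ (-β) ≤ C * (D ^ β * ((N : ℝ) / Real.log N) ^ (-β)) := by gcongr
          _ = (C * D ^ β) * ((N : ℝ) / Real.log N) ^ (-β) := by ring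
          _ ≤ _ := by gcongr; exact le_max_right _ _
      · gcongr; exact le_max_left _ _
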